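/- **Definitions.** A composition of $n\ge 0$ is a finite list of positive integers (its parts) with sum $n$. A meander $\frac{\lambda}{\mu}$ with $n$ nodes is given by a pair of compositions $\lambda,\mu$ of $n$. Fix a field $K$ of characteristic $0$ (for example $K=\mathbb C$). The seaweed Lie algebra $\mathfrak p_n\frac{\lambda}{\mu}\subseteq\mathfrak{gl}_n(K)$ consists of the matrices whose nonzero entries strictly above the diagonal lie in the consecutive diagonal blocks of sizes $\lambda_1,\lambda_2,\dots$ and whose nonzero entries strictly below the diagonal lie in the consecutive diagonal blocks of sizes $\mu_1,\mu_2,\dots$. The index $\operatorname{ind}\frac{\lambda}{\mu}$ of the meander is the index of $\mathfrak g=\mathfrak p_n\frac{\lambda}{\mu}$, that is, $\min_{f\in\mathfrak g^*}\dim\{x\in\mathfrak g: f([x,y])=0\text{ for all }y\in\mathfrak g\}$. The direct sum of $\frac{\lambda}{\mu}$ and $\frac{\lambda'}{\mu'}$ is obtained by concatenating $\lambda$ with $\lambda'$ and $\mu$ with $\mu'$; a meander is indecomposable if it is not a direct sum of two meanders with strictly fewer nodes. For a set $J$ of positive integers let $a^J_{n,k}$ be the number of meanders with $n$ nodes and index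 $k$ such that all parts of $\lambda$ and $\mu$ belong to $J$, let $i^J_{n,k}$ ($k\in\mathbb Z$) be the number of indecomposable ones among them (so $i^J_{n,k}=0$ for $k<0$), and let $A_J(x,y)=\sum_{n,k\ge 0}a^J_{n,k}x^ny^k$ as a formal power series. **Theorem.** 1. $A_{\{1,7\}}(x,y)=\dfrac{f(x,y)}{g(x,y)}$, where $g$ is invertible as a formal power series and $$\begin{aligned} f &=1 - x^4 y- x^5 y^2 - x^6 y^3 - 3 x^7 y - 2 x^8 y^2 - x^9 y^3 - x^{18} y^3 - x^{21} y^3 + 2 x^{11} y^2 + 2 x^{12} y^3 + 3 x^{14} y^2 + 2 x^{15} y^3,\\ g &= f\cdot(1-xy-x^7y^7) - 2x^7y^4- 2x^8y^2 - 2x^9y^3-2x^{10}y^4+2x^{12}y^3+4x^{13}y^4+4x^{15}y^3+4x^{16}y^4-2x^{19}y^4 - 2x^{22}y^4. \end{aligned}$$ 2. Writing $i_{n,k}=i^{\{1,7\}}_{n,k}$, for all $n>28$ and all $k\in\mathbb Z$, $$\begin{aligned} i_{n,k} ={}& i_{n-4,k-1} + i_{n-6,k-3} + 3 i_{n-7,k-1}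 + i_{n-5,k-2} + 2 i_{n-8,k-2} + i_{n-9,k-3} + i_{n-18,k-3} + i_{n-21,k-3}\\ & - 2i_{n-11,k-2} -2 i_{n-12,k-3} - 3 i_{n-14,k-2} - 2 i_{n-15,k-3}. \end{aligned}$$ 3. For every integer $c\ge 1$, $A_{\{c,7c\}}(x,y)=A_{\{1,7\}}(x^c,y^c)$. -/

import Mathlib

/-- The stabilizer `𝔤_f = {x ∈ 𝔤 | f ⁅x, y⁆ = 0 for all y ∈ 𝔤}` of a linear form `f ∈ 𝔤*`
under the coadjoint action. -/
def coadjointStabilizer (K L : Type*) [Field K] [LieRing L] [LieAlgebra K L]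
    (f : Module.Dual K L) : Submodule K L where
  carrier := {x | ∀ y : L, f ⁅x, y⁆ = 0}
  add_mem' := by
    intro a b ha hb y
    simp [add_lie, ha y, hb y]
  zero_mem' := by
    intro y
    simp
  smul_mem' := by
    intro c a ha y
    simp [smul_lie, ha y]

/-- The index of a (finite-dimensional) Lie algebra `𝔤`: the minimum over `f ∈ 𝔤*` of the
dimension of the stabilizer `𝔤_f`. -/
noncomputable def lieIndex (K L : Type*) [Field K] [LieRing L] [LieAlgebra K L] : ℕ :=
  sInf (Set.range fun f : Module.Dual K L => Module.finrank K (coadjointStabilizer K L f))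

theorem composition_index_mono {n : ℕ} (c : Composition n) {i j : Fin n} (h : i ≤ j) :
    c.index i ≤ c.index j := by
  by_contra hlt
  have hlt' : (c.index j : ℕ) + 1 ≤ c.index i := by
    have := Fin.lt_def.mp (not_le.mp hlt)
    omega
  have h1 := c.lt_sizeUpTo_index_succ j
  have h2 := c.monotone_sizeUpTo hlt'
  have h3 := c.sizeUpTo_index_le i
  have h4 : (i : ℕ) ≤ j := h
  simp only [Fin.val_succ] at h1
  omega

/-- The matrices whose nonzero entries strictly above the diagonal lie in the diagonal blocks cut
out by the composition `lam`, and whose nonzero entries strictly below the diagonal lie in the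
diagonal blocks cut out by the composition `mu`. They are closed under matrix multiplication.
(`c.index i` is the number of the block of the composition `c` that contains the position `i`.) -/
def seaweedSubalgebra (K : Type*) [Field K] {n : ℕ} (lam mu : Composition n) :
    Subalgebra K (Matrix (Fin n) (Fin n) K) where
  carrier := {A | ∀ i j, A i j ≠ 0 →
    (i < j → lam.index i = lam.index j) ∧ (j < i → mu.index i = mu.index j)}
  mul_mem' := by
    intro A B hA hB i j hij
    rw [Matrix.mul_apply] at hij
    obtain ⟨k, -, hk⟩ := Finset.exists_ne_zero_of_sum_ne_zero hij
    have hAk := hA i k (left_ne_zero_of_mul hk)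
    have hBk := hB k j (right_ne_zero_of_mul hk)
    have key : ∀ (c : Composition n) (a b : Fin n), a < b →
        (a < k → c.index a = c.index k) → (k < b → c.index k = c.index b) →
        c.index a = c.index b := by
      intro c a b hab h1 h2
      rcases le_or_gt k a with hka | hka
      · have hkb := h2 (lt_of_le_of_lt hka hab)
        exact le_antisymm (composition_index_mono c hab.le)
          (hkb ▸ composition_index_mono c hka)
      · rcases le_or_gt b k with hbk | hbk
        · exact le_antisymm (composition_index_mono c hab.le)
            ((h1 hka).symm ▸ composition_index_mono c hbk)
        · exact (h1 hka).trans (h2 hbk)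
    exact ⟨fun h => key lam i j h hAk.1 hBk.1,
      fun h => (key mu j i h (fun h' => (hBk.2 h').symm) (fun h' => (hAk.2 h').symm)).symm⟩
  add_mem' := by
    intro A B hA hB i j hij
    by_cases h : A i j = 0
    · exact hB i j (fun h' => hij (by simp [h, h']))
    · exact hA i j h
  algebraMap_mem' := by
    intro r i j hij
    have : i = j := by
      by_contra hne
      exact hij (by simp [Matrix.algebraMap_matrix_apply, hne])
    subst this
    exact ⟨fun _ => rfl, fun _ => rfl⟩

attribute [local instance] LieRing.ofAssociativeRing

/-- The seaweed Lie algebra `𝔭_n(lam / mu) ⊆ 𝔤𝔩_n(K)`, with the commutator bracket. -/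
def seaweed (K : Type*) [Field K] {n : ℕ} (lam mu : Composition n) :
    LieSubalgebra K (Matrix (Fin n) (Fin n) K) :=
  lieSubalgebraOfSubalgebra K (Matrix (Fin n) (Fin n) K) (seaweedSubalgebra K lam mu)

/-- A meander `lam / mu` with `n` nodes: `top` and `bot` are its upper and lower composition. -/
structure Meander (n : ℕ) where
  top : Composition n
  bot : Composition n

namespace Meander

/-- The index of a meander: the index of its seaweed algebra. -/
noncomputable def ind (K : Type*) [Field K] {n : ℕ} (M : Meander n) : ℕ :=
  lieIndex K (seaweed K M.top M.bot)

/-- All parts of both compositions belong to `J`. -/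
def PartsIn {n : ℕ} (M : Meander n) (J : Set ℕ) : Prop :=
  (∀ p ∈ M.top.blocks, p ∈ J) ∧ (∀ p ∈ M.bot.blocks, p ∈ J)

/-- The direct sum of meanders: upper and lower compositions are concatenated. -/
def directSum {m n : ℕ} (M : Meander m) (N : Meander n) : Meander (m + n) :=
  ⟨M.top.append N.top, M.bot.append N.bot⟩

/-- `M` is the direct sum of two strictly smaller meanders. -/
def Decomposable {n : ℕ} (M : Meander n) : Prop :=
  ∃ (a b : ℕ) (P : Meander a) (Q : Meander b), a < n ∧ b < n ∧
    M.top.blocks = (P.directSum Q).top.blocks ∧ M.bot.blocks = (P.directSum Q).bot.blocks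

end Meander

/-- `a_{n,k}^J`: the number of meanders with `n` nodes, parts in `J` and index `k`. -/
noncomputable def meanderCount (K : Type*) [Field K] (J : Set ℕ) (n k : ℕ) : ℕ :=
  {M : Meander n | M.PartsIn J ∧ M.ind K = k}.ncard

/-- `i_{n,k}^J`: the number of indecomposable meanders with `n` nodes, parts in `J` and index `k`
(which is `0` for negative `k`). -/
noncomputable def indecomposableCount (K : Type*) [Field K] (J : Set ℕ) (n : ℕ) (k : ℤ) : ℕ :=
  {M : Meander n | M.PartsIn J ∧ ¬ M.Decomposable ∧ (M.ind K : ℤ) = k}.ncard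

/-- `A_J(x, y) = ∑ a_{n,k}^J x ^ n y ^ k`, a formal power series in `x` (the variable `0`)
and `y` (the variable `1`). -/
noncomputable def meanderGenFun (K : Type*) [Field K] (J : Set ℕ) : MvPowerSeries (Fin 2) ℚ :=
  fun m => (meanderCount K J (m 0) (m 1) : ℚ)

/-- The numerator `f` in `A_{1,7} = f / g`. -/
noncomputable def numeratorPoly : MvPolynomial (Fin 2) ℚ :=
  let x : MvPolynomial (Fin 2) ℚ := MvPolynomial.X 0
  let y : MvPolynomial (Fin 2) ℚ := MvPolynomial.X 1
  1 - x ^ 4 * y - x ^ 5 * y ^ 2 - x ^ 6 * y ^ 3 - 3 * x ^ 7 * y - 2 * x ^ 8 * y ^ 2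
    - x ^ 9 * y ^ 3 - x ^ 18 * y ^ 3 - x ^ 21 * y ^ 3 + 2 * x ^ 11 * y ^ 2
    + 2 * x ^ 12 * y ^ 3 + 3 * x ^ 14 * y ^ 2 + 2 * x ^ 15 * y ^ 3

/-- The denominator `g` in `A_{1,7} = f / g`. -/
noncomputable def denominatorPoly : MvPolynomial (Fin 2) ℚ :=
  let x : MvPolynomial (Fin 2) ℚ := MvPolynomial.X 0
  let y : MvPolynomial (Fin 2) ℚ := MvPolynomial.X 1
  numeratorPoly * (1 - x * y - x ^ 7 * y ^ 7) - 2 * x ^ 7 * y ^ 4 - 2 * x ^ 8 * y ^ 2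
    - 2 * x ^ 9 * y ^ 3 - 2 * x ^ 10 * y ^ 4 + 2 * x ^ 12 * y ^ 3 + 4 * x ^ 13 * y ^ 4
    + 4 * x ^ 15 * y ^ 3 + 4 * x ^ 16 * y ^ 4 - 2 * x ^ 19 * y ^ 4 - 2 * x ^ 22 * y ^ 4

/-! Index. A seaweed algebra consists of the matrices supported on a preorder of `Fin n`, and every
linear form on it is `X ↦ tr (F X)`. So its index is the least dimension of the radical of `tr (F
[X, Y])` (`relIndex`). Suppose the first parts are `a` above and `b` below with `a < b`. Let `U` be
the first `a` positions and `W` the positions from `a` to `b - 1`. The block `W × U` is an abelian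
ideal `V`, all of whose entries are allowed. For generic `F`, conjugation inside the algebra turns
the block of `F` on `U × W` into the matrix of a partial matching `σ`. Then `V` is isotropic and
misses the radical, and its orthogonal complement is `V` plus a copy of the seaweed algebra in which
matched positions are identified. Reduction along `V` keeps the dimension of the radical
(`finrank_ker_eq_finrank_ker_pullback`, `IsFold.finrank_ker_eq`), and semicontinuity on lines of
forms makes the generic normal form sufficient (`le_relIndex_of_generic`). Hence the index is
unchanged (`IsFold.relIndex_eq`). Equal first parts `a` split off `𝔤𝔩_a`, of index `a`
(`relIndex_fullSumRel`). Together this gives the recursion `redIndex` on first parts.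

Counting. Read the parts of a pair from left to right, always on the side that is behind. Until the
sums agree again, the other side leads by some `s` between 1 and 7, and what the reduction leaves of
the parts already read depends on `s` only: `[1]`, `[1,1]`, `[1,1,1]`, `[1,1,1,1]`, `[3,1,1]`,
`[5,1]`, `[7]`. The next part is 1 or 7, so the seven generating functions of completions satisfy a
linear system over the generating function `z` of what may follow a return to equality. Elimination
gives `numeratorSeries_mul_completionGenFun`. With `z = A` it becomes `g A = f`. With `z = 1` it
becomes `f ψ = r` for a polynomial `r`, where `ψ` counts indecomposables in `x`-degree above 7;
comparing coefficients gives the recurrence. The scaling law holds because `redIndex` is homogeneous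
of degree 1. -/

/-! ### Radicals of bilinear forms: reduction along an isotropic subspace, and semicontinuity. -/

section BilinearForms

open Module

/-- If the orthogonal complement of an isotropic subspace `V` that avoids the radical is
`V ⊕ φ(E')`, then `φ` pulls the form back to one with a radical of the same dimension. -/
theorem finrank_ker_eq_finrank_ker_pullback {K E E' : Type*} [Field K] [AddCommGroup E]
    [Module K E] [AddCommGroup E'] [Module K E'] [FiniteDimensional K E]
    [FiniteDimensional K E']
    (B : LinearMap.BilinForm K E) (hB : B.IsRefl) (V : Submodule K E) (φ : E' →ₗ[K] E)
    (hV : ∀ v ∈ V, (∀ x, B v x = 0) → v = 0)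
    (hperp : ∀ x, (∀ v ∈ V, B x v = 0) ↔ ∃ v ∈ V, ∃ z, x = v + φ z)
    (hdisj : ∀ z, φ z ∈ V → z = 0) :
    finrank K (LinearMap.ker B) = finrank K (LinearMap.ker (B.compl₁₂ φ φ)) := by
  have hP : ∀ x, x ∈ B.orthogonal V ↔ ∃ v ∈ V, ∃ z, x = v + φ z := by
    intro x
    rw [← hperp x, LinearMap.BilinForm.mem_orthogonal_iff]
    exact ⟨fun h v hv => hB _ _ (h v hv), fun h v hv => hB _ _ (h v hv)⟩
  have hrad : ∀ x, x ∈ LinearMap.ker B ↔ ∀ y, B x y = 0 := by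
    intro x
    rw [LinearMap.mem_ker]
    exact ⟨fun h y => by rw [h]; rfl, fun h => LinearMap.ext h⟩
  have hVker : V ⊓ LinearMap.ker B = ⊥ := by
    rw [eq_bot_iff]
    rintro v ⟨hv, hk⟩
    exact hV v hv ((hrad v).1 hk)
  have hVP : V ≤ B.orthogonal V := fun v hv => (hP v).2 ⟨v, hv, 0, by simp⟩
  -- With `P = V^⊥`, the two counts read `dim V + dim P = dim E` (since `V` misses the radical) and
  -- `dim P + dim P^⊥ = dim E + dim rad B`. Hence `dim P^⊥ = dim V + dim rad B`, and it remains to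
  -- see that `P^⊥` is the direct sum of `V` and the image of the radical of the pullback.
  have h1 := LinearMap.BilinForm.finrank_add_finrank_orthogonal' (B := B) V
  have h2 := LinearMap.BilinForm.finrank_add_finrank_orthogonal' (B := B) (B.orthogonal V)
  have hkP : LinearMap.ker B ≤ B.orthogonal V := by
    intro x hx
    rw [LinearMap.BilinForm.mem_orthogonal_iff]
    exact fun v _ => hB _ _ ((hrad x).1 hx v)
  rw [inf_eq_right.2 hkP] at h2
  change finrank K V + _ = _ + finrank K ↥(V ⊓ LinearMap.ker B) at h1
  rw [hVker, finrank_bot] at h1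
  have hPP : B.orthogonal (B.orthogonal V)
      = V ⊔ (LinearMap.ker (B.compl₁₂ φ φ)).map φ := by
    apply le_antisymm
    · intro x hx
      have hx' : ∀ v ∈ V, ∀ z, B x (v + φ z) = 0 := fun v hv z =>
        hB _ _ ((LinearMap.BilinForm.mem_orthogonal_iff).1 hx _ ((hP _).2 ⟨v, hv, z, rfl⟩))
      obtain ⟨v, hv, z, rfl⟩ := (hperp x).1 fun v hv => by simpa using hx' v hv 0
      refine Submodule.add_mem_sup hv (Submodule.mem_map_of_mem ?_)
      rw [LinearMap.mem_ker]
      ext z'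
      have h3 := hx' 0 V.zero_mem z'
      have h4 := hB _ _ ((hperp (φ z')).2 ⟨0, V.zero_mem, z', by simp⟩ v hv)
      simp only [zero_add, map_add, LinearMap.add_apply, h4] at h3
      simpa using h3
    · refine sup_le (LinearMap.BilinForm.le_orthogonal_orthogonal hB) ?_
      rintro _ ⟨z, hz, rfl⟩
      rw [LinearMap.BilinForm.mem_orthogonal_iff]
      intro y hy
      obtain ⟨v, hv, z', rfl⟩ := (hP y).1 hy
      have h4 := hB _ _ ((hperp (φ z)).2 ⟨0, V.zero_mem, z, by simp⟩ v hv)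
      have h5 : B (φ z) (φ z') = 0 := by
        have := LinearMap.congr_fun (LinearMap.mem_ker.1 hz) z'
        simpa using this
      have h6 := hB _ _ h5
      change B (v + φ z') (φ z) = 0
      simp [h4, h6]
  have hinj : Function.Injective φ := by
    rw [← LinearMap.ker_eq_bot, eq_bot_iff]
    intro z hz
    exact hdisj z (by rw [LinearMap.mem_ker.1 hz]; exact V.zero_mem)
  have h7 := Submodule.finrank_sup_add_finrank_inf_eq V ((LinearMap.ker (B.compl₁₂ φ φ)).map φ)
  have h8 : V ⊓ (LinearMap.ker (B.compl₁₂ φ φ)).map φ = ⊥ := by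
    rw [eq_bot_iff]
    rintro _ ⟨hv, z, -, rfl⟩
    rw [hdisj z hv]
    simp
  have h9 : finrank K ((LinearMap.ker (B.compl₁₂ φ φ)).map φ)
      = finrank K (LinearMap.ker (B.compl₁₂ φ φ)) :=
    (Submodule.equivMapOfInjective φ hinj _).finrank_eq.symm
  rw [h8, finrank_bot, h9] at h7
  rw [hPP] at h2
  omega

open Polynomial in
/-- Along a line of linear maps the dimension of the kernel does not go up generically. -/
theorem exists_finrank_ker_le_of_eval_ne_zero {K E E' : Type*} [Field K] [Infinite K]
    [AddCommGroup E] [Module K E] [AddCommGroup E'] [Module K E'] [FiniteDimensional K E]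
    (L₀ L₁ : E →ₗ[K] E') (P : K[X]) (hP : P ≠ 0) :
    ∃ t : K, P.eval t ≠ 0 ∧
      finrank K (LinearMap.ker (L₀ + t • L₁)) ≤ finrank K (LinearMap.ker L₀) := by
  classical
  obtain ⟨C, hC⟩ := Submodule.exists_isCompl (LinearMap.ker L₀)
  have hinj : LinearMap.ker (L₀.domRestrict C) = ⊥ := by
    rw [eq_bot_iff]
    rintro ⟨c, hc⟩ h
    have : c ∈ LinearMap.ker L₀ ⊓ C := ⟨by simpa using h, hc⟩
    rw [hC.inf_eq_bot] at this
    simpa using this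
  obtain ⟨p, hp⟩ := LinearMap.exists_leftInverse_of_injective _ hinj
  let b := Module.finBasis K C
  let M₀ := LinearMap.toMatrix b b (p ∘ₗ L₀.domRestrict C)
  let M₁ := LinearMap.toMatrix b b (p ∘ₗ L₁.domRestrict C)
  -- `Q(t)` is the determinant of `p ∘ (L₀ + t L₁)` on the complement `C` of `ker L₀`, and `Q(0) =
  -- 1`. Where `Q(t) ≠ 0`, the map is injective on `C`, so its kernel has dimension at most the
  -- codimension of `C`.
  let Q : K[X] := (M₀.map Polynomial.C + (X : K[X]) • M₁.map Polynomial.C).det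
  have hQ : ∀ t, Q.eval t = (M₀ + t • M₁).det := by
    intro t
    rw [← Polynomial.coe_evalRingHom, RingHom.map_det]
    congr 1
    ext i j
    simp
    ring
  have hQ0 : Q ≠ 0 := by
    intro h
    have h0 := hQ 0
    rw [h] at h0
    simp [M₀, hp] at h0
  obtain ⟨t, ht⟩ : ∃ t, (P * Q).eval t ≠ 0 := by
    by_contra! h
    exact mul_ne_zero hP hQ0 (Polynomial.funext (by simpa using h))
  rw [Polynomial.eval_mul] at ht
  refine ⟨t, left_ne_zero_of_mul ht, ?_⟩
  have hdet := right_ne_zero_of_mul ht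
  rw [hQ] at hdet
  have hinj' : LinearMap.ker ((L₀ + t • L₁).domRestrict C) = ⊥ := by
    have h1 : M₀ + t • M₁ = LinearMap.toMatrix b b (p ∘ₗ (L₀ + t • L₁).domRestrict C) := by
      simp only [M₀, M₁, ← map_smul, ← map_add]
      congr 1
      ext x
      simp
    rw [h1, LinearMap.det_toMatrix] at hdet
    have h2 := LinearMap.ker_eq_bot.2
      (LinearMap.equivOfDetNeZero _ hdet).injective
    rw [eq_bot_iff] at h2 ⊢
    intro x hx
    apply h2
    simp only [LinearMap.mem_ker] at hx ⊢
    change p ((L₀ + t • L₁).domRestrict C x) = 0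
    rw [hx, map_zero]
  have hd : LinearMap.ker (L₀ + t • L₁) ⊓ C = ⊥ := by
    rw [eq_bot_iff]
    rintro c ⟨h, hc⟩
    have : (⟨c, hc⟩ : C) ∈ LinearMap.ker ((L₀ + t • L₁).domRestrict C) := by
      simpa using h
    rw [hinj'] at this
    simpa using this
  have h3 := Submodule.finrank_sup_add_finrank_inf_eq (LinearMap.ker (L₀ + t • L₁)) C
  have h4 := Submodule.finrank_add_eq_of_isCompl hC
  have h5 := Submodule.finrank_le (LinearMap.ker (L₀ + t • L₁) ⊔ C)
  rw [hd, finrank_bot] at h3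
  omega

end BilinearForms

/-! ### Matrices supported on a relation, their trace forms, and the index of the relation. -/

section RelationIndex

open Module Matrix

variable {K : Type*} [Field K] {ι ι' : Type*}

/-- The matrices supported on the relation `R`. -/
def incidence (K : Type*) [Field K] {ι : Type*} (R : ι → ι → Prop) :
    Submodule K (Matrix ι ι K) where
  carrier := {A | ∀ i j, A i j ≠ 0 → R i j}
  add_mem' := by
    intro A B hA hB i j hij
    by_cases h : A i j = 0
    · exact hB i j (fun h' => hij (by simp [h, h']))
    · exact hA i j h
  zero_mem' := by simp
  smul_mem' := by
    intro c A hA i j hij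
    exact hA i j (right_ne_zero_of_mul hij)

theorem eq_zero_of_mem_incidence {R : ι → ι → Prop} {A : Matrix ι ι K} (hA : A ∈ incidence K R)
    {i j : ι} (h : ¬ R i j) : A i j = 0 := by
  by_contra h'
  exact h (hA i j h')

theorem one_mem_incidence [DecidableEq ι] {R : ι → ι → Prop} (hR : ∀ i, R i i) :
    (1 : Matrix ι ι K) ∈ incidence K R := by
  intro i j hij
  rw [Matrix.one_apply] at hij
  split_ifs at hij with h
  · exact h ▸ hR i
  · exact absurd rfl hij

theorem single_mem_incidence [DecidableEq ι] {R : ι → ι → Prop} {i j : ι} (h : R i j) (c : K) :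
    Matrix.single i j c ∈ incidence K R := by
  intro i' j' hij
  rw [Matrix.single_apply] at hij
  split_ifs at hij with h'
  · obtain ⟨rfl, rfl⟩ := h'
    exact h
  · exact absurd rfl hij

variable [Fintype ι] [Fintype ι']

theorem mul_mem_incidence {R : ι → ι → Prop} (hR : ∀ i j k, R i j → R j k → R i k)
    {A B : Matrix ι ι K} (hA : A ∈ incidence K R) (hB : B ∈ incidence K R) :
    A * B ∈ incidence K R := by
  intro i j hij
  rw [Matrix.mul_apply] at hij
  obtain ⟨k, -, hk⟩ := Finset.exists_ne_zero_of_sum_ne_zero hij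
  exact hR _ _ _ (hA i k (left_ne_zero_of_mul hk)) (hB k j (right_ne_zero_of_mul hk))

/-- Left multiplication by `g` is injective on the finite-dimensional algebra of matrices supported
on `R`, hence surjective, so it reaches 1. -/
theorem exists_inverse_mem_incidence [DecidableEq ι] {R : ι → ι → Prop} (hr : ∀ i, R i i)
    (ht : ∀ i j k, R i j → R j k → R i k) {g : Matrix ι ι K} (hg : g ∈ incidence K R)
    (hdet : g.det ≠ 0) : ∃ h ∈ incidence K R, h * g = 1 ∧ g * h = 1 := by
  have hu : IsUnit g.det := isUnit_iff_ne_zero.2 hdet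
  let m : incidence K R →ₗ[K] incidence K R :=
    (LinearMap.mulLeft K g).restrict fun x hx => mul_mem_incidence ht hg hx
  have hinj : Function.Injective m := by
    intro x y hxy
    have h1 : g * x.1 = g * y.1 := congrArg Subtype.val hxy
    have h2 := congrArg (g⁻¹ * ·) h1
    simp only [← Matrix.mul_assoc, Matrix.nonsing_inv_mul _ hu, Matrix.one_mul] at h2
    exact Subtype.ext h2
  obtain ⟨h, hh⟩ := (LinearMap.injective_iff_surjective.1 hinj) ⟨1, one_mem_incidence hr⟩
  have h1 : g * h.1 = 1 := congrArg Subtype.val hh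
  exact ⟨h.1, h.2, mul_eq_one_comm.1 h1, h1⟩

/-- The form `(X, Y) ↦ tr (F [X, Y])` on the matrices supported on `R`. -/
noncomputable def relForm (R : ι → ι → Prop) (F : Matrix ι ι K) :
    LinearMap.BilinForm K (incidence K R) :=
  LinearMap.mk₂ K (fun X Y => trace (F * (X.1 * Y.1 - Y.1 * X.1)))
    (by intros; simp [Matrix.mul_add, Matrix.add_mul, Matrix.mul_sub]; ring)
    (by intros; simp [Matrix.mul_sub]; ring)
    (by intros; simp [Matrix.mul_add, Matrix.add_mul, Matrix.mul_sub]; ring)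
    (by intros; simp [Matrix.mul_sub]; ring)

theorem relForm_apply (R : ι → ι → Prop) (F : Matrix ι ι K) (X Y : incidence K R) :
    relForm R F X Y = trace (F * (X.1 * Y.1 - Y.1 * X.1)) := rfl

theorem relForm_apply' (R : ι → ι → Prop) (F : Matrix ι ι K) (X Y : incidence K R) :
    relForm R F X Y = trace ((F * X.1 - X.1 * F) * Y.1) := by
  rw [relForm_apply, Matrix.mul_sub, Matrix.sub_mul, trace_sub, trace_sub, ← Matrix.mul_assoc,
    ← Matrix.mul_assoc, Matrix.trace_mul_comm (F * Y.1), ← Matrix.mul_assoc]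

theorem relForm_isRefl (R : ι → ι → Prop) (F : Matrix ι ι K) : (relForm R F).IsRefl := by
  intro X Y h
  rw [relForm_apply] at h ⊢
  rw [← neg_sub, Matrix.mul_neg, trace_neg, h, neg_zero]

theorem mem_ker_relForm {R : ι → ι → Prop} {F : Matrix ι ι K} {X : incidence K R} :
    X ∈ LinearMap.ker (relForm R F) ↔ ∀ i j, R i j → (F * X.1 - X.1 * F) j i = 0 := by
  classical
  rw [LinearMap.mem_ker]
  constructor
  · intro h i j hij
    have h1 := LinearMap.congr_fun h ⟨single i j 1, single_mem_incidence hij 1⟩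
    rw [relForm_apply'] at h1
    simpa [Matrix.trace_mul_single] using h1
  · intro h
    ext Y
    rw [relForm_apply', Matrix.trace]
    refine Finset.sum_eq_zero fun j _ => ?_
    rw [Matrix.diag_apply, Matrix.mul_apply]
    refine Finset.sum_eq_zero fun i _ => ?_
    by_cases hij : R i j
    · rw [h i j hij, zero_mul]
    · rw [eq_zero_of_mem_incidence Y.2 hij, mul_zero]

/-- The index of the Lie algebra of matrices supported on `R`. -/
noncomputable def relIndex (K : Type*) [Field K] {ι : Type*} [Fintype ι] (R : ι → ι → Prop) : ℕ :=
  sInf (Set.range fun F : Matrix ι ι K => finrank K (LinearMap.ker (relForm R F)))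

theorem relIndex_le (R : ι → ι → Prop) (F : Matrix ι ι K) :
    relIndex K R ≤ finrank K (LinearMap.ker (relForm R F)) :=
  Nat.sInf_le ⟨F, rfl⟩

theorem exists_relIndex_eq (K : Type*) [Field K] (R : ι → ι → Prop) :
    ∃ F : Matrix ι ι K, finrank K (LinearMap.ker (relForm R F)) = relIndex K R :=
  Nat.sInf_mem (Set.range_nonempty
    fun F : Matrix ι ι K => finrank K (LinearMap.ker (relForm R F)))

theorem relForm_add_smul (R : ι → ι → Prop) (F G : Matrix ι ι K) (t : K) :
    relForm R (F + t • G) = relForm R F + t • relForm R G := by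
  ext X Y
  simp [relForm_apply, Matrix.add_mul, trace_add]

open Polynomial in
/-- A lower bound for the dimension of the stabilizer of a generic form bounds the index. -/
theorem le_relIndex_of_generic [Infinite K] (R : ι → ι → Prop) (k : ℕ)
    (h : ∀ F₀ : Matrix ι ι K, ∃ (G : Matrix ι ι K) (P : K[X]), P ≠ 0 ∧
      ∀ t, P.eval t ≠ 0 → k ≤ finrank K (LinearMap.ker (relForm R (F₀ + t • G)))) :
    k ≤ relIndex K R := by
  obtain ⟨F₀, hF₀⟩ := exists_relIndex_eq K R
  obtain ⟨G, P, hP, hk⟩ := h F₀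
  -- A generic point of a line through a minimiser `F₀` has a kernel no larger than that of `F₀`,
  -- and the assumed lower bound applies there.
  obtain ⟨t, ht, hle⟩ :=
    exists_finrank_ker_le_of_eval_ne_zero (relForm R F₀) (relForm R G) P hP
  rw [← relForm_add_smul] at hle
  rw [← hF₀]
  exact (hk t ht).trans hle

/-- The map `x ↦ g x h` carries the stabilizer of `h F g` into that of `F`, because `F (g x h) - (g
x h) F = g ((h F g) x - x (h F g)) h`. This permits normalising `F` by conjugation. -/
theorem finrank_ker_relForm_conj_le [DecidableEq ι] {R : ι → ι → Prop}
    (hR : ∀ i j k, R i j → R j k → R i k)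
    {g h : Matrix ι ι K} (hg : g ∈ incidence K R) (hh : h ∈ incidence K R) (hgh : g * h = 1)
    (F : Matrix ι ι K) :
    finrank K (LinearMap.ker (relForm R (h * F * g))) ≤
      finrank K (LinearMap.ker (relForm R F)) := by
  have hhg : h * g = 1 := mul_eq_one_comm.1 hgh
  let c : incidence K R →ₗ[K] incidence K R :=
    (LinearMap.mulRight K h ∘ₗ LinearMap.mulLeft K g).restrict
      fun x hx => mul_mem_incidence hR (mul_mem_incidence hR hg hx) hh
  have hc : ∀ x, (c x).1 = g * x.1 * h := fun x => rfl
  have hinj : Function.Injective c := by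
    intro x y hxy
    have h1 : g * x.1 * h = g * y.1 * h := congrArg Subtype.val hxy
    have h2 : h * (g * x.1 * h) * g = h * (g * y.1 * h) * g := by rw [h1]
    have h3 : ∀ z : Matrix ι ι K, h * (g * z * h) * g = z := by
      intro z
      rw [← Matrix.mul_assoc, ← Matrix.mul_assoc, hhg, Matrix.one_mul, Matrix.mul_assoc, hhg,
        Matrix.mul_one]
    rw [h3, h3] at h2
    exact Subtype.ext h2
  have hmaps : ∀ x ∈ LinearMap.ker (relForm R (h * F * g)),
      c x ∈ LinearMap.ker (relForm R F) := by
    intro x hx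
    rw [LinearMap.mem_ker] at hx ⊢
    ext Y
    have hY := LinearMap.congr_fun hx
      ⟨h * Y.1 * g, mul_mem_incidence hR (mul_mem_incidence hR hh Y.2) hg⟩
    rw [relForm_apply', LinearMap.zero_apply] at hY
    rw [relForm_apply', LinearMap.zero_apply, ← hY, hc]
    have e1 : (F * (g * x.1 * h) - g * x.1 * h * F)
        = g * ((h * F * g) * x.1 - x.1 * (h * F * g)) * h := by
      have e2 : g * ((h * F * g) * x.1) * h = (g * h) * F * (g * x.1 * h) := by
        simp only [Matrix.mul_assoc]
      have e3 : g * (x.1 * (h * F * g)) * h = g * x.1 * h * F * (g * h) := by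
        simp only [Matrix.mul_assoc]
      rw [Matrix.mul_sub, Matrix.sub_mul, e2, e3, hgh, Matrix.one_mul, Matrix.mul_one]
    rw [e1, Matrix.mul_assoc, Matrix.mul_assoc, Matrix.trace_mul_comm]
    simp only [Matrix.mul_assoc]
  exact LinearMap.finrank_le_finrank_of_injective (f := c.restrict hmaps)
    fun x y hxy => Subtype.ext (hinj (congrArg Subtype.val hxy))

theorem exists_trace_mul_eq (f : Matrix ι ι K →ₗ[K] K) :
    ∃ F : Matrix ι ι K, ∀ X, f X = trace (F * X) := by
  classical
  refine ⟨Matrix.of fun i j => f (single j i 1), fun X => ?_⟩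
  conv_lhs => rw [Matrix.matrix_eq_sum_single X]
  simp only [map_sum, Matrix.trace, Matrix.diag_apply, Matrix.mul_apply]
  rw [Finset.sum_comm]
  refine Finset.sum_congr rfl fun j _ => Finset.sum_congr rfl fun i _ => ?_
  rw [← mul_one (X i j), ← smul_eq_mul, ← Matrix.smul_single, map_smul, smul_eq_mul, mul_comm,
    smul_eq_mul, mul_one]
  rfl

theorem relForm_compl₁₂ {R : ι → ι → Prop} {R' : ι' → ι' → Prop}
    {F : Matrix ι ι K} {F' : Matrix ι' ι' K} (φ : incidence K R' →ₗ[K] incidence K R)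
    (h : ∀ X Y : incidence K R', trace (F * ((φ X).1 * (φ Y).1)) = trace (F' * (X.1 * Y.1))) :
    (relForm R F).compl₁₂ φ φ = relForm R' F' := by
  ext X Y
  rw [LinearMap.compl₁₂_apply, relForm_apply, relForm_apply, Matrix.mul_sub, Matrix.mul_sub,
    trace_sub, trace_sub, h, h]

end RelationIndex

/-! ### Folding a preorder along a matching. -/

section Fold

open Module Matrix

/-- `R'` arises from the preorder `R` by identifying, along the involution `σ`, points of the down
set `U` with points of `W`, where all entries in `W × U` are allowed by `R`. The quotient map is
`π`. -/
structure IsFold {ι ι' : Type*} (R : ι → ι → Prop) (R' : ι' → ι' → Prop) (U W : ι → Prop)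
    (σ : ι → ι) (π : ι → ι') : Prop where
  refl : ∀ i, R i i
  trans : ∀ i j k, R i j → R j k → R i k
  trans' : ∀ x y z, R' x y → R' y z → R' x z
  row_U : ∀ i j, R i j → U i → U j
  col_U : ∀ i j, R i j → U j → U i ∨ W i
  col_W : ∀ i j, R i j → W j → W i
  not_U : ∀ i, W i → ¬ U i
  full_WU : ∀ i j, W i → U j → R i j
  full_U : ∀ i j, U i → U j → R i j
  invol : ∀ i, σ (σ i) = i
  map_eq_iff : ∀ i j, π i = π j ↔ i = j ∨ j = σ i
  map_surj : Function.Surjective π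
  map_U : ∀ i, U i → W (σ i) ∨ σ i = i
  map_W : ∀ i, W i → U (σ i) ∨ σ i = i
  map_other : ∀ i, ¬ U i → ¬ W i → σ i = i
  -- `rel_U` and `rel_not_U` say which entries survive in a matrix whose commutator with the
  -- matching vanishes on `U × W`: entries at matched pairs agree, and an entry whose counterpart is
  -- missing on one side must vanish.
  rel_U : ∀ i j, U i → U j → (R' (π i) (π j) ↔ R i j ∧ (W (σ j) → W (σ i) ∧ R (σ i) (σ j)))
  rel_not_U : ∀ i j, ¬ U i → ¬ U j →
    (R' (π i) (π j) ↔ R i j ∧ (U (σ i) → W j → U (σ j)))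
  rel_lift : ∀ x y, R' x y → ∃ i j, π i = x ∧ π j = y ∧ (U i ↔ U j)
  -- Either `U` is fully matched into `W`, and then the allowed entries from matched to unmatched
  -- points of `W` serve to clear unmatched columns of `F`; or `W` is fully matched and there are
  -- none.
  complete : (∀ i, U i → W (σ i) ∧ ∀ j, W j → ¬ U (σ j) → R (σ i) j) ∨ (∀ j, W j → U (σ j))

/-- Pulling back matrices along `π`, block by block. -/
noncomputable def foldMap (K : Type*) [Field K] {ι ι' : Type*} (U : ι → Prop) (π : ι → ι') :
    Matrix ι' ι' K →ₗ[K] Matrix ι ι K where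
  toFun Z := Matrix.of fun i j => by
    classical exact if (U i ↔ U j) then Z (π i) (π j) else 0
  map_add' := by
    intro X Y
    ext i j
    by_cases h : U i ↔ U j <;> simp [h]
  map_smul' := by
    intro c X
    ext i j
    by_cases h : U i ↔ U j <;> simp [h]

open scoped Classical in
/-- A section of `foldMap`: entries are read off in the block `U × U` or, failing that, in its
complement. -/
noncomputable def unfoldMap (K : Type*) [Field K] {ι ι' : Type*} (U : ι → Prop) (π : ι → ι') :
    Matrix ι ι K →ₗ[K] Matrix ι' ι' K where
  toFun X := Matrix.of fun x y =>
      if h : ∃ p : ι × ι, (U p.1 ∧ U p.2) ∧ π p.1 = x ∧ π p.2 = y then 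
        X h.choose.1 h.choose.2
      else if h : ∃ p : ι × ι, (¬ U p.1 ∧ ¬ U p.2) ∧ π p.1 = x ∧ π p.2 = y then
        X h.choose.1 h.choose.2
      else 0
  map_add' := by
    intro X Y
    ext x y
    simp only [Matrix.of_apply, Matrix.add_apply]
    split_ifs <;> simp
  map_smul' := by
    intro c X
    ext x y
    simp only [Matrix.of_apply, Matrix.smul_apply]
    split_ifs <;> simp

section

variable {K : Type*} [Field K] {ι ι' : Type*} {U : ι → Prop} {π : ι → ι'}

theorem foldMap_apply_of_iff (Z : Matrix ι' ι' K) {i j : ι} (h : U i ↔ U j) :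
    foldMap K U π Z i j = Z (π i) (π j) := by
  simp [foldMap, h]

theorem foldMap_apply_of_not_iff (Z : Matrix ι' ι' K) {i j : ι} (h : ¬ (U i ↔ U j)) :
    foldMap K U π Z i j = 0 := by
  simp [foldMap, h]

theorem unfoldMap_apply_eq_zero (X : Matrix ι ι K) {x y : ι'}
    (hxy : ∀ i j, π i = x → π j = y → ¬ (U i ↔ U j)) : unfoldMap K U π X x y = 0 := by
  classical
  have hnex : ¬ ∃ p : ι × ι, (U p.1 ∧ U p.2) ∧ π p.1 = x ∧ π p.2 = y := by
    rintro ⟨p, ⟨h1, h2⟩, h3, h4⟩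
    exact hxy _ _ h3 h4 (iff_of_true h1 h2)
  have hnex' : ¬ ∃ p : ι × ι, (¬ U p.1 ∧ ¬ U p.2) ∧ π p.1 = x ∧ π p.2 = y := by
    rintro ⟨p, ⟨h1, h2⟩, h3, h4⟩
    exact hxy _ _ h3 h4 (iff_of_false h1 h2)
  simp only [unfoldMap, LinearMap.coe_mk, AddHom.coe_mk, Matrix.of_apply, dif_neg hnex,
    dif_neg hnex']

end

namespace IsFold

variable {K : Type*} [Field K] {ι ι' : Type*} {R : ι → ι → Prop} {R' : ι' → ι' → Prop}
  {U W : ι → Prop} {σ : ι → ι} {π : ι → ι'} (h : IsFold R R' U W σ π)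

include h

theorem map_sigma (i : ι) : π (σ i) = π i := by
  rw [eq_comm, h.map_eq_iff]
  exact Or.inr rfl

/-- The fibres of `π` are the orbits `{i, σ i}`, and a point moved by `σ` has exactly one end in
`U`. So `π` is injective on `U` and on its complement. -/
theorem eq_of_map_eq {i j : ι} (hij : U i ↔ U j) (he : π i = π j) : i = j := by
  rcases (h.map_eq_iff i j).1 he with h1 | h1
  · exact h1
  · by_cases hU : U i
    · rcases h.map_U i hU with h2 | h2
      · exact absurd (hij.1 hU) (h.not_U j (h1 ▸ h2))
      · rw [h1, h2]
    · by_cases hW : W i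
      · rcases h.map_W i hW with h2 | h2
        · exact absurd (hij.2 (h1 ▸ h2)) hU
        · rw [h1, h2]
      · rw [h1, h.map_other i hU hW]

theorem sigma_of_map_eq {i j : ι} (hij : ¬ (U i ↔ U j)) (he : π i = π j) : j = σ i := by
  rcases (h.map_eq_iff i j).1 he with h1 | h1
  · exact absurd (by rw [h1]) hij
  · exact h1

theorem unfoldMap_apply_U (X : Matrix ι ι K) {i j : ι} (hi : U i) (hj : U j) :
    unfoldMap K U π X (π i) (π j) = X i j := by
  classical
  have hex : ∃ p : ι × ι, (U p.1 ∧ U p.2) ∧ π p.1 = π i ∧ π p.2 = π j := ⟨(i, j), ⟨hi, hj⟩, rfl, rfl⟩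
  have h1 := hex.choose_spec
  simp only [unfoldMap, LinearMap.coe_mk, AddHom.coe_mk, Matrix.of_apply, dif_pos hex]
  rw [h.eq_of_map_eq (iff_of_true h1.1.1 hi) h1.2.1, h.eq_of_map_eq (iff_of_true h1.1.2 hj) h1.2.2]

theorem unfoldMap_apply_not_U (X : Matrix ι ι K) {i j : ι} (hi : ¬ U i) (hj : ¬ U j)
    (hij : ¬ (U (σ i) ∧ U (σ j))) :
    unfoldMap K U π X (π i) (π j) = X i j := by
  classical
  have hex : ∃ p : ι × ι, (¬ U p.1 ∧ ¬ U p.2) ∧ π p.1 = π i ∧ π p.2 = π j :=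
    ⟨(i, j), ⟨hi, hj⟩, rfl, rfl⟩
  have hnex : ¬ ∃ p : ι × ι, (U p.1 ∧ U p.2) ∧ π p.1 = π i ∧ π p.2 = π j := by
    rintro ⟨p, ⟨h1, h2⟩, h3, h4⟩
    refine hij ⟨?_, ?_⟩
    · rwa [← h.sigma_of_map_eq (by simp [hi, h1]) h3.symm]
    · rwa [← h.sigma_of_map_eq (by simp [hj, h2]) h4.symm]
  have h1 := hex.choose_spec
  simp only [unfoldMap, LinearMap.coe_mk, AddHom.coe_mk, Matrix.of_apply, dif_pos hex,
    dif_neg hnex]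
  rw [h.eq_of_map_eq (iff_of_false h1.1.1 hi) h1.2.1, h.eq_of_map_eq (iff_of_false h1.1.2 hj) h1.2.2]

theorem W_sigma_of_U {i : ι} (hi : ¬ U i) (hU : U (σ i)) : W i := by
  by_contra hW
  rw [h.map_other i hi hW] at hU
  exact hi hU

theorem foldMap_mem (Z : Matrix ι' ι' K) (hZ : Z ∈ incidence K R') :
    foldMap K U π Z ∈ incidence K R := by
  intro i j hij
  by_cases h1 : U i ↔ U j
  · rw [foldMap_apply_of_iff Z h1] at hij
    have h2 := hZ _ _ hij
    by_cases hU : U i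
    · exact ((h.rel_U i j hU (h1.1 hU)).1 h2).1
    · exact ((h.rel_not_U i j hU (fun h' => hU (h1.2 h'))).1 h2).1
  · rw [foldMap_apply_of_not_iff Z h1] at hij
    exact absurd rfl hij

/-- `foldMap` as a map between the matrices supported on `R'` and on `R`. -/
noncomputable def foldIncidence (K : Type*) [Field K] : incidence K R' →ₗ[K] incidence K R :=
  (foldMap K U π).restrict fun Z hZ => h.foldMap_mem Z hZ

theorem coe_foldIncidence (Z : incidence K R') :
    (h.foldIncidence K Z).1 = foldMap K U π Z.1 := rfl

theorem unfoldMap_foldMap (Z : Matrix ι' ι' K) (hZ : Z ∈ incidence K R') :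
    unfoldMap K U π (foldMap K U π Z) = Z := by
  ext x y
  by_cases hex : ∃ i j, π i = x ∧ π j = y ∧ (U i ↔ U j)
  · obtain ⟨i, j, rfl, rfl, hij⟩ := hex
    by_cases hi : U i
    · rw [h.unfoldMap_apply_U _ hi (hij.1 hi), foldMap_apply_of_iff _ hij]
    · have hj : ¬ U j := fun h' => hi (hij.2 h')
      by_cases hs : U (σ i) ∧ U (σ j)
      · rw [← h.map_sigma i, ← h.map_sigma j, h.unfoldMap_apply_U _ hs.1 hs.2,
          foldMap_apply_of_iff _ (iff_of_true hs.1 hs.2)]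
      · rw [h.unfoldMap_apply_not_U _ hi hj hs, foldMap_apply_of_iff _ hij]
  · rw [unfoldMap_apply_eq_zero _ fun i j h1 h2 h3 => hex ⟨i, j, h1, h2, h3⟩]
    by_contra hne
    exact hex (h.rel_lift x y (hZ x y (Ne.symm hne)))

/-- This makes `foldMap` multiplicative: no term of a product in the quotient is lost in a diagonal
block. If `z` had lifts on the other side only, both relations would lift there, between a lift `k`
of `z` and the partners of `i` and `j`. Then `rel_U` or `rel_not_U` places `σ k`, another lift of
`z`, on the side of `i`. -/
theorem exists_same_side {x y z : ι'} {i j : ι} (hij : U i ↔ U j) (hx : π i = x) (hy : π j = y)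
    (h1 : R' x z) (h2 : R' z y) : ∃ k, π k = z ∧ (U k ↔ U i) := by
  subst hx hy
  by_contra! hno
  obtain ⟨k, rfl⟩ := h.map_surj z
  have hk : ∀ k', π k' = π k → ¬ (U k' ↔ U i) := fun k' hk' => by
    have := hno k' hk'
    tauto
  have hik : ∃ i₁, i₁ = σ i ∧ (U i₁ ↔ U k) ∧ R' (π i₁) (π k) := by
    obtain ⟨i₁, k₁, e1, e2, e3⟩ := h.rel_lift _ _ h1
    have e4 := hk k₁ e2
    have e5 := hk k rfl
    refine ⟨i₁, h.sigma_of_map_eq (by tauto) e1.symm, by tauto, by rwa [e1]⟩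
  have hkj : ∃ j₁, j₁ = σ j ∧ (U k ↔ U j₁) ∧ R' (π k) (π j₁) := by
    obtain ⟨k₁, j₁, e1, e2, e3⟩ := h.rel_lift _ _ h2
    have e4 := hk k₁ e1
    have e5 := hk k rfl
    refine ⟨j₁, h.sigma_of_map_eq (by tauto) e2.symm, by tauto, by rwa [e2]⟩
  obtain ⟨_, rfl, hi1, hi2⟩ := hik
  obtain ⟨_, rfl, hj1, hj2⟩ := hkj
  have hki := hk k rfl
  by_cases hU : U k
  · have hi' : U (σ i) := hi1.2 hU
    have hj' : U (σ j) := hj1.1 hU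
    have hUj : ¬ U j := by tauto
    have hWj : W j := h.W_sigma_of_U hUj hj'
    have e := ((h.rel_U k (σ j) hU hj').1 hj2).2 (by rwa [h.invol])
    exact hk (σ k) (h.map_sigma k) (by
      have := h.not_U _ e.1
      tauto)
  · have hi' : ¬ U (σ i) := by tauto
    have hj' : ¬ U (σ j) := by tauto
    have hUj : U j := by tauto
    have hUi : U i := by tauto
    have hWsj : W (σ j) := by
      rcases h.map_U j hUj with e | e
      · exact e
      · rw [e] at hj'
        exact absurd hUj hj'
    have hWk : W k := h.col_W _ _ ((h.rel_not_U k (σ j) hU hj').1 hj2).1 hWsj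
    have e := ((h.rel_not_U (σ i) k hi' hU).1 hi2).2 (by rwa [h.invol]) hWk
    exact hk (σ k) (h.map_sigma k) (by tauto)

variable [Fintype ι]

theorem foldMap_mul [Fintype ι'] (Z Z' : Matrix ι' ι' K) (hZ : Z ∈ incidence K R') (hZ' : Z' ∈ incidence K R') :
    foldMap K U π (Z * Z') = foldMap K U π Z * foldMap K U π Z' := by
  classical
  ext i j
  by_cases hij : U i ↔ U j
  · rw [foldMap_apply_of_iff _ hij, Matrix.mul_apply, Matrix.mul_apply]
    have h1 : ∑ k, foldMap K U π Z i k * foldMap K U π Z' k j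
        = ∑ k ∈ Finset.univ.filter fun k => (U k ↔ U i), Z (π i) (π k) * Z' (π k) (π j) := by
      rw [Finset.sum_filter]
      refine Finset.sum_congr rfl fun k _ => ?_
      by_cases hk : U k ↔ U i
      · rw [if_pos hk, foldMap_apply_of_iff _ hk.symm, foldMap_apply_of_iff _ (hk.trans hij)]
      · rw [if_neg hk, foldMap_apply_of_not_iff _ fun h' => hk h'.symm, zero_mul]
    rw [h1, ← Finset.sum_image (f := fun z => Z (π i) z * Z' z (π j)) (g := π)]
    · symm
      refine Finset.sum_subset (Finset.subset_univ _) fun z _ hz => ?_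
      by_contra hne
      obtain ⟨k, hk1, hk2⟩ := h.exists_same_side hij rfl rfl
        (hZ _ _ (left_ne_zero_of_mul hne)) (hZ' _ _ (right_ne_zero_of_mul hne))
      exact hz (Finset.mem_image.2 ⟨k, by simp [hk2], hk1⟩)
    · intro k hk k' hk' he
      simp only [Finset.coe_filter, Finset.mem_univ, true_and, Set.mem_ofPred_eq] at hk hk'
      exact h.eq_of_map_eq (hk.trans hk'.symm) he
  · rw [foldMap_apply_of_not_iff _ hij, Matrix.mul_apply]
    symm
    refine Finset.sum_eq_zero fun k _ => ?_
    by_cases hk : U i ↔ U k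
    · rw [foldMap_apply_of_not_iff Z' fun h' => hij (hk.trans h'), mul_zero]
    · rw [foldMap_apply_of_not_iff Z hk, zero_mul]

/-- On the block `U × W` only the entries of `F` in that same block matter, as rows of `X` in `U`
stay in `U` and columns in `W` come from `W`. There `F` is a partial permutation, so each sum has at
most one term. -/
theorem comm_apply [DecidableEq ι] [DecidablePred U] [DecidablePred W] (F : Matrix ι ι K)
    (hF : ∀ i j, U i → W j → F i j = if σ i = j then 1 else 0)
    (X : Matrix ι ι K) (hX : X ∈ incidence K R) {u w : ι} (hu : U u) (hw : W w) :
    (F * X - X * F) u w = (if W (σ u) then X (σ u) w else 0) -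
      (if U (σ w) then X u (σ w) else 0) := by
  rw [Matrix.sub_apply, Matrix.mul_apply, Matrix.mul_apply]
  congr 1
  · rw [Finset.sum_eq_single (σ u)]
    · split_ifs with hs
      · rw [hF _ _ hu hs, if_pos rfl, one_mul]
      · rw [eq_zero_of_mem_incidence hX fun h' => hs (h.col_W _ _ h' hw), mul_zero]
    · intro k _ hk
      by_cases hR : R k w
      · rw [hF _ _ hu (h.col_W _ _ hR hw), if_neg (Ne.symm hk), zero_mul]
      · rw [eq_zero_of_mem_incidence hX hR, mul_zero]
    · simp
  · rw [Finset.sum_eq_single (σ w)]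
    · split_ifs with hs
      · rw [hF _ _ hs hw, if_pos (h.invol w), mul_one]
      · rw [eq_zero_of_mem_incidence hX fun h' => hs (h.row_U _ _ h' hu), zero_mul]
    · intro k _ hk
      by_cases hR : R u k
      · rw [hF _ _ (h.row_U _ _ hR hu) hw, if_neg, mul_zero]
        rintro rfl
        exact hk (h.invol k).symm
      · rw [eq_zero_of_mem_incidence hX hR, zero_mul]
    · simp

end IsFold

end Fold

/-! ### Folding preserves the radical for forms in normal form, and bounds the index above. -/

section FoldIndex

open Module Matrix

namespace IsFold

variable {K : Type*} [Field K] {ι ι' : Type*} {R : ι → ι → Prop} {R' : ι' → ι' → Prop}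
  {U W : ι → Prop} {σ : ι → ι} {π : ι → ι'} (h : IsFold R R' U W σ π)

include h

theorem unfoldMap_mem [DecidableEq ι] [DecidablePred U] [DecidablePred W] (X : Matrix ι ι K)
    (hX : X ∈ incidence K R)
    (hc : ∀ u w, U u → W w → (if W (σ u) then X (σ u) w else 0) =
      (if U (σ w) then X u (σ w) else 0)) :
    unfoldMap K U π X ∈ incidence K R' := by
  intro x y hxy
  by_cases hex : ∃ i j, π i = x ∧ π j = y ∧ (U i ↔ U j)
  · obtain ⟨i, j, rfl, rfl, hij⟩ := hex
    have key : ∀ i j, U i → U j → unfoldMap K U π X (π i) (π j) ≠ 0 → R' (π i) (π j) := by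
      intro i j hi hj hxy
      rw [h.unfoldMap_apply_U _ hi hj] at hxy
      refine (h.rel_U i j hi hj).2 ⟨hX _ _ hxy, fun hW => ?_⟩
      have := hc i (σ j) hi hW
      rw [h.invol, if_pos hj] at this
      split_ifs at this with hW'
      · exact ⟨hW', hX _ _ (by rwa [this])⟩
      · exact absurd this.symm hxy
    by_cases hi : U i
    · exact key i j hi (hij.1 hi) hxy
    · have hj : ¬ U j := fun h' => hi (hij.2 h')
      by_cases hs : U (σ i) ∧ U (σ j)
      · rw [← h.map_sigma i, ← h.map_sigma j] at hxy ⊢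
        exact key _ _ hs.1 hs.2 hxy
      · rw [h.unfoldMap_apply_not_U _ hi hj hs] at hxy
        refine (h.rel_not_U i j hi hj).2 ⟨hX _ _ hxy, fun hU hW => ?_⟩
        by_contra hU'
        have := hc (σ i) j hU hW
        rw [if_neg hU', h.invol, if_pos (h.W_sigma_of_U hi hU)] at this
        exact hxy this
  · exact absurd (unfoldMap_apply_eq_zero _ fun i j h1 h2 h3 => hex ⟨i, j, h1, h2, h3⟩) hxy

theorem foldMap_unfoldMap_apply [DecidableEq ι] [DecidablePred U] [DecidablePred W]
    (X : Matrix ι ι K)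
    (hc : ∀ u w, U u → W w → (if W (σ u) then X (σ u) w else 0) =
      (if U (σ w) then X u (σ w) else 0)) {i j : ι} (hij : U i ↔ U j) :
    foldMap K U π (unfoldMap K U π X) i j = X i j := by
  rw [foldMap_apply_of_iff _ hij]
  by_cases hi : U i
  · exact h.unfoldMap_apply_U _ hi (hij.1 hi)
  · have hj : ¬ U j := fun h' => hi (hij.2 h')
    by_cases hs : U (σ i) ∧ U (σ j)
    · rw [← h.map_sigma i, ← h.map_sigma j, h.unfoldMap_apply_U _ hs.1 hs.2]
      have := hc (σ i) j hs.1 (h.W_sigma_of_U hj hs.2)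
      rw [h.invol, if_pos (h.W_sigma_of_U hi hs.1), if_pos hs.2] at this
      exact this.symm
    · exact h.unfoldMap_apply_not_U _ hi hj hs

variable [Fintype ι] [Fintype ι']

/-- Reduction along the ideal `V` of matrices supported on `W × U`. Its orthogonal complement
consists of the `X` whose commutator with `F` vanishes on `U × W`; modulo `V` these are exactly the
folded matrices. -/
theorem finrank_ker_eq (F : Matrix ι ι K) (F' : Matrix ι' ι' K) [DecidableEq ι]
    (hF : ∀ i j, U i → W j → F i j = if σ i = j then 1 else 0)
    (hF' : ∀ Z ∈ incidence K R', trace (F * foldMap K U π Z) = trace (F' * Z)) :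
    finrank K (LinearMap.ker (relForm R F)) = finrank K (LinearMap.ker (relForm R' F')) := by
  classical
  let V : Submodule K (incidence K R) :=
    { carrier := {X | ∀ i j, X.1 i j ≠ 0 → ¬ U i ∧ U j}
      add_mem' := by
        intro X Y hX hY i j hij
        by_cases h0 : X.1 i j = 0
        · exact hY i j fun h' => hij (by simp [h0, h'])
        · exact hX i j h0
      zero_mem' := by simp
      smul_mem' := by
        intro c X hX i j hij
        exact hX i j (right_ne_zero_of_mul hij) }
  have hVz : ∀ v ∈ V, ∀ i j, ¬ (¬ U i ∧ U j) → v.1 i j = 0 := fun v hv i j hij => by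
    by_contra h'
    exact hij (hv i j h')
  have hpull : (relForm R F).compl₁₂ (h.foldIncidence K) (h.foldIncidence K) = relForm R' F' := by
    refine relForm_compl₁₂ _ fun X Y => ?_
    rw [h.coe_foldIncidence, h.coe_foldIncidence, ← h.foldMap_mul _ _ X.2 Y.2]
    exact hF' _ (mul_mem_incidence h.trans' X.2 Y.2)
  rw [← hpull]
  refine finrank_ker_eq_finrank_ker_pullback _ (relForm_isRefl R F) V _ ?_ ?_ ?_
  · intro v hv hker
    have hk := mem_ker_relForm.1 (LinearMap.mem_ker.2 (LinearMap.ext hker))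
    ext w u
    rw [Submodule.coe_zero, Matrix.zero_apply]
    by_cases hwu : ¬ U w ∧ U u
    swap
    · exact hVz v hv _ _ hwu
    by_contra hne
    have hW : W w := (h.col_U _ _ (v.2 _ _ hne) hwu.2).resolve_left hwu.1
    -- If `w` is matched, the entry of `F v - v F` at `(σ w, u)` is `v w u`. Otherwise `u` is
    -- matched, and the entry at `(w, σ u)` is `-v w u`.
    by_cases hUw : U (σ w)
    · have h1 := hk u (σ w) (h.full_U _ _ hwu.2 hUw)
      rw [Matrix.sub_apply, Matrix.mul_apply, Matrix.mul_apply, Finset.sum_eq_single w,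
        Finset.sum_eq_zero, hF _ _ hUw hW, h.invol, if_pos rfl, one_mul, sub_zero] at h1
      · exact hne h1
      · intro k _
        rw [hVz v hv _ _ fun h' => h'.1 hUw, zero_mul]
      · intro k _ hkw
        by_cases hR : R k u
        · rcases h.col_U _ _ hR hwu.2 with hUk | hWk
          · rw [hVz v hv _ _ fun h' => h'.1 hUk, mul_zero]
          · rw [hF _ _ hUw hWk, h.invol, if_neg (Ne.symm hkw), zero_mul]
        · rw [eq_zero_of_mem_incidence v.2 hR, mul_zero]
      · simp
    · rcases h.complete with hcomp | hcomp
      swap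
      · exact hUw (hcomp w hW)
      obtain ⟨hWu, hRu⟩ := hcomp u hwu.2
      have h1 := hk (σ u) w (hRu w hW hUw)
      rw [Matrix.sub_apply, Matrix.mul_apply, Matrix.mul_apply, Finset.sum_eq_zero,
        Finset.sum_eq_single u, hF _ _ hwu.2 hWu, if_pos rfl, mul_one, zero_sub,
        neg_eq_zero] at h1
      · exact hne h1
      · intro k _ hku
        by_cases hUk : U k
        · rw [hF _ _ hUk hWu, if_neg, mul_zero]
          intro he
          apply hku
          rw [← h.invol k, he, h.invol]
        · rw [hVz v hv _ _ fun h' => hUk h'.2, zero_mul]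
      · simp
      · intro k _
        rw [hVz v hv _ _ fun h' => h.not_U _ hWu h'.2, mul_zero]
  · intro x
    have hsingle : (∀ v ∈ V, relForm R F x v = 0) ↔
        ∀ u w, U u → W w → (F * x.1 - x.1 * F) u w = 0 := by
      constructor
      · intro hx u w hu hw
        have h1 := hx ⟨single w u 1, single_mem_incidence (h.full_WU _ _ hw hu) 1⟩ (by
          intro i j hij
          change single w u (1 : K) i j ≠ 0 at hij
          rw [Matrix.single_apply] at hij
          split_ifs at hij with h'
          · obtain ⟨rfl, rfl⟩ := h'
            exact ⟨h.not_U _ hw, hu⟩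
          · exact absurd rfl hij)
        rw [relForm_apply'] at h1
        simpa [Matrix.trace_mul_single] using h1
      · intro hx v hv
        rw [relForm_apply', Matrix.trace]
        refine Finset.sum_eq_zero fun u _ => ?_
        rw [Matrix.diag_apply, Matrix.mul_apply]
        refine Finset.sum_eq_zero fun w _ => ?_
        by_cases hne : v.1 w u = 0
        · rw [hne, mul_zero]
        · have h1 := hv _ _ hne
          rw [hx u w h1.2 ((h.col_U _ _ (v.2 _ _ hne) h1.2).resolve_left h1.1), zero_mul]
    rw [hsingle]
    constructor
    · intro hx
      have hc : ∀ u w, U u → W w → (if W (σ u) then x.1 (σ u) w else 0) =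
          (if U (σ w) then x.1 u (σ w) else 0) := fun u w hu hw => by
        have := hx u w hu hw
        rw [h.comm_apply F hF x.1 x.2 hu hw] at this
        exact sub_eq_zero.1 this
      let z : incidence K R' := ⟨unfoldMap K U π x.1, h.unfoldMap_mem _ x.2 hc⟩
      refine ⟨x - h.foldIncidence K z, ?_, z, by simp⟩
      intro i j hij
      rw [Submodule.coe_sub, Matrix.sub_apply, h.coe_foldIncidence] at hij
      by_cases hs : U i ↔ U j
      · rw [h.foldMap_unfoldMap_apply _ hc hs, sub_self] at hij
        exact absurd rfl hij
      · rw [foldMap_apply_of_not_iff _ hs, sub_zero] at hij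
        have := h.row_U _ _ (x.2 _ _ hij)
        tauto
    · rintro ⟨v, hv, z, rfl⟩ u w hu hw
      have hv1 : (if W (σ u) then v.1 (σ u) w else 0) = 0 := by
        rw [hVz v hv _ _ fun h' => h.not_U _ hw h'.2, ite_self]
      have hv2 : (if U (σ w) then v.1 u (σ w) else 0) = 0 := by
        rw [hVz v hv _ _ fun h' => h'.1 hu, ite_self]
      rw [Submodule.coe_add, Matrix.mul_add, Matrix.add_mul, add_sub_add_comm, Matrix.add_apply,
        h.comm_apply F hF v.1 v.2 hu hw, hv1, hv2, sub_zero, zero_add,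
        h.comm_apply F hF _ (h.foldIncidence K z).2 hu hw, h.coe_foldIncidence, sub_eq_zero]
      have hUw := h.not_U _ hw
      by_cases h1 : W (σ u)
      · have hUsu := h.not_U _ h1
        rw [if_pos h1, foldMap_apply_of_iff _ (iff_of_false hUsu hUw), h.map_sigma]
        split_ifs with h2
        · rw [foldMap_apply_of_iff _ (iff_of_true hu h2), h.map_sigma]
        · by_contra hne
          have := z.2 _ _ hne
          rw [← h.map_sigma u, h.rel_not_U _ _ hUsu hUw, h.invol] at this
          exact h2 (this.2 hu hw)
      · rw [if_neg h1]
        split_ifs with h2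
        · rw [foldMap_apply_of_iff _ (iff_of_true hu h2)]
          by_contra hne
          have := z.2 _ _ (Ne.symm hne)
          rw [h.rel_U _ _ hu h2, h.invol] at this
          exact h1 (this.2 hw).1
        · rfl
  · intro z hz
    ext x y
    rw [Submodule.coe_zero, Matrix.zero_apply]
    by_contra hne
    obtain ⟨i, j, rfl, rfl, hij⟩ := h.rel_lift _ _ (z.2 _ _ hne)
    have := hz i j (by rwa [h.coe_foldIncidence, foldMap_apply_of_iff _ hij])
    tauto

/-- An optimal form `F'` for the quotient is transported by `unfoldMap`, and the matching is added
on `U × W`. The two parts do not interfere: `unfoldMap` ignores `W × U`, and the matching pairs to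
zero with folded matrices. -/
theorem relIndex_le_relIndex (K : Type*) [Field K] : relIndex K R ≤ relIndex K R' := by
  classical
  obtain ⟨F', hF'⟩ := exists_relIndex_eq K R'
  let N : Matrix ι ι K := Matrix.of fun i j => if U i ∧ W j ∧ σ i = j then 1 else 0
  obtain ⟨F, hF⟩ := exists_trace_mul_eq
    ((Matrix.traceLinearMap ι' K K ∘ₗ LinearMap.mulLeft K F') ∘ₗ unfoldMap K U π +
      Matrix.traceLinearMap ι K K ∘ₗ LinearMap.mulLeft K N)
  simp only [LinearMap.add_apply, LinearMap.comp_apply, LinearMap.mulLeft_apply,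
    Matrix.traceLinearMap_apply] at hF
  have htr : ∀ (G : Matrix ι ι K) i j, trace (G * single j i 1) = G i j := by
    intro G i j
    simp [Matrix.trace_mul_single]
  rw [← hF', ← h.finrank_ker_eq F F' ?_ ?_]
  · exact relIndex_le R F
  · intro u w hu hw
    have h1 := hF (single w u 1)
    rw [htr, htr] at h1
    have h2 : unfoldMap K U π (single w u 1) = 0 := by
      ext x y
      rw [Matrix.zero_apply]
      by_cases hex : ∃ i j, π i = x ∧ π j = y ∧ (U i ↔ U j)
      · obtain ⟨i, j, rfl, rfl, hij⟩ := hex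
        have hUw := h.not_U _ hw
        have h3 : ∀ i j, (U i ↔ U j) → single w u (1 : K) i j = 0 := fun i j hij => by
          rw [Matrix.single_apply, if_neg]
          rintro ⟨rfl, rfl⟩
          exact hUw (hij.2 hu)
        by_cases hi : U i
        · rw [h.unfoldMap_apply_U _ hi (hij.1 hi), h3 _ _ hij]
        · have hj : ¬ U j := fun h' => hi (hij.2 h')
          by_cases hs : U (σ i) ∧ U (σ j)
          · rw [← h.map_sigma i, ← h.map_sigma j, h.unfoldMap_apply_U _ hs.1 hs.2,
              h3 _ _ (iff_of_true hs.1 hs.2)]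
          · rw [h.unfoldMap_apply_not_U _ hi hj hs, h3 _ _ hij]
      · exact unfoldMap_apply_eq_zero _ fun i j h1 h2 h3 => hex ⟨i, j, h1, h2, h3⟩
    rw [h2, Matrix.mul_zero, trace_zero, zero_add] at h1
    rw [← h1]
    simp [N, hu, hw]
  · intro Z hZ
    rw [← hF, h.unfoldMap_foldMap Z hZ]
    have h0 : trace (N * foldMap K U π Z) = 0 := by
      rw [Matrix.trace]
      refine Finset.sum_eq_zero fun i _ => ?_
      rw [Matrix.diag_apply, Matrix.mul_apply]
      refine Finset.sum_eq_zero fun j _ => ?_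
      by_cases hij : U j ↔ U i
      · have : N i j = 0 := by
          simp only [N, Matrix.of_apply]
          rw [if_neg]
          rintro ⟨h1, h2, -⟩
          exact h.not_U _ h2 (hij.2 h1)
        rw [this, zero_mul]
      · rw [foldMap_apply_of_not_iff _ hij, mul_zero]
    rw [h0, add_zero]

end IsFold

end FoldIndex

/-! ### Generic forms can be brought to normal form, which bounds the index below. -/

section FoldIndex

open Module Matrix

namespace IsFold

variable {K : Type*} [Field K] {ι ι' : Type*} {R : ι → ι → Prop} {R' : ι' → ι' → Prop}
  {U W : ι → Prop} {σ : ι → ι} {π : ι → ι'} (h : IsFold R R' U W σ π)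
  [Fintype ι] [Fintype ι']

include h

theorem le_finrank_ker_of_normal (F : Matrix ι ι K) [DecidableEq ι]
    (hF : ∀ i j, U i → W j → F i j = if σ i = j then 1 else 0) :
    relIndex K R' ≤ finrank K (LinearMap.ker (relForm R F)) := by
  obtain ⟨F', hF'⟩ := exists_trace_mul_eq
    ((Matrix.traceLinearMap ι K K ∘ₗ LinearMap.mulLeft K F) ∘ₗ foldMap K U π)
  rw [h.finrank_ker_eq F F' hF fun Z _ => hF' Z]
  exact relIndex_le R' F'

/-- The unmatched columns of `W` are cleared by conjugating with the unipotent matrix `1 + N`. Here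
`N` copies the entries to be killed into rows indexed by matched points of `W`, so `F * N`
reproduces them. -/
theorem le_finrank_ker_of_normal_on_matched (F : Matrix ι ι K) [DecidableEq ι]
    (hF : ∀ i j, U i → W j → U (σ j) → F i j = if σ i = j then 1 else 0) :
    relIndex K R' ≤ finrank K (LinearMap.ker (relForm R F)) := by
  classical
  rcases h.complete with hcomp | hcomp
  swap
  · exact h.le_finrank_ker_of_normal F fun i j hi hj => hF i j hi hj (hcomp j hj)
  let N : Matrix ι ι K := Matrix.of fun i j =>
    if W i ∧ U (σ i) ∧ W j ∧ ¬ U (σ j) then F (σ i) j else 0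
  have hN : ∀ i j, ¬ (W i ∧ U (σ i) ∧ W j ∧ ¬ U (σ j)) → N i j = 0 := fun i j hij => if_neg hij
  have hNmem : N ∈ incidence K R := by
    intro i j hij
    by_cases hc : W i ∧ U (σ i) ∧ W j ∧ ¬ U (σ j)
    · have := (hcomp (σ i) hc.2.1).2 j hc.2.2.1 hc.2.2.2
      rwa [h.invol] at this
    · exact absurd (hN i j hc) hij
  have hNN : N * N = 0 := by
    ext i j
    rw [Matrix.mul_apply, Matrix.zero_apply]
    refine Finset.sum_eq_zero fun k _ => ?_
    by_cases hk : U (σ k)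
    · rw [hN i k fun h' => h'.2.2.2 hk, zero_mul]
    · rw [hN k j fun h' => hk h'.2.1, mul_zero]
  have h1 : (1 : Matrix ι ι K) ∈ incidence K R := one_mem_incidence h.refl
  have hgh : (1 - N) * (1 + N) = 1 := by
    rw [Matrix.sub_mul, Matrix.mul_add, Matrix.mul_add, hNN]
    simp
  refine le_trans (h.le_finrank_ker_of_normal ((1 + N) * F * (1 - N)) fun u w hu hw => ?_)
    (finrank_ker_relForm_conj_le h.trans (Submodule.sub_mem _ h1 hNmem)
      (Submodule.add_mem _ h1 hNmem) hgh F)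
  have hNu : ∀ k, N u k = 0 := fun k => hN u k fun h' => h.not_U _ h'.1 hu
  have e1 : ((1 + N) * F * (1 - N)) u w = F u w - (F * N) u w := by
    rw [Matrix.mul_assoc, Matrix.add_mul, Matrix.one_mul, Matrix.add_apply,
      Matrix.mul_apply (M := N), Finset.sum_eq_zero fun k _ => by rw [hNu, zero_mul], add_zero,
      Matrix.mul_sub, Matrix.mul_one, Matrix.sub_apply]
  obtain ⟨hWu, -⟩ := hcomp u hu
  have e2 : (F * N) u w = N (σ u) w := by
    rw [Matrix.mul_apply, Finset.sum_eq_single (σ u)]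
    · rw [hF u (σ u) hu hWu (by rwa [h.invol]), if_pos rfl, one_mul]
    · intro k _ hk
      by_cases hc : W k ∧ U (σ k) ∧ W w ∧ ¬ U (σ w)
      · rw [hF u k hu hc.1 hc.2.1, if_neg (Ne.symm hk), zero_mul]
      · rw [hN k w hc, mul_zero]
    · simp
  rw [e1, e2]
  by_cases hUw : U (σ w)
  · rw [hN _ _ fun h' => h'.2.2.2 hUw, sub_zero, hF u w hu hw hUw]
  · have e3 : N (σ u) w = F u w := by
      simp only [N, Matrix.of_apply, h.invol]
      rw [if_pos ⟨hWu, hu, hw, hUw⟩]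
    rw [e3, sub_self, if_neg]
    rintro rfl
    rw [h.invol] at hUw
    exact hUw hu

-- For generic `F` the block of `F` between `U` and its matched columns, completed by identity
-- columns to `g F`, is invertible. Conjugating by `g F` turns that block into the matching.
open Polynomial in
theorem relIndex_ge_relIndex [Infinite K] : relIndex K R' ≤ relIndex K R := by
  classical
  refine le_relIndex_of_generic R _ fun F₀ => ?_
  let c : ι → ι → Prop := fun i j => U i ∧ U j ∧ W (σ j)
  let g : Matrix ι ι K → Matrix ι ι K := fun F => Matrix.of fun i j =>
    if c i j then F i (σ j) else if i = j then 1 else 0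
  -- The line passes at `t = 1` through the permutation matrix of `σ`, for which `g` is the
  -- identity; hence `P(1) = 1` and `P ≠ 0`.
  let G : Matrix ι ι K := Matrix.of (fun i j => if σ i = j then 1 else 0) - F₀
  let P : K[X] := (Matrix.of fun i j =>
    if c i j then C (F₀ i (σ j)) + X * C (G i (σ j)) else if i = j then 1 else 0).det
  have hP : ∀ t, P.eval t = (g (F₀ + t • G)).det := by
    intro t
    rw [← Polynomial.coe_evalRingHom, RingHom.map_det]
    congr 1
    ext i j
    simp only [g, RingHom.mapMatrix_apply, Matrix.map_apply, Matrix.of_apply,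
      Polynomial.coe_evalRingHom]
    split_ifs
    · simp
      ring
    · simp
    · simp
  refine ⟨G, P, ?_, ?_⟩
  · intro h0
    have h1 := hP 1
    have h2 : g (F₀ + (1 : K) • G) = 1 := by
      ext i j
      simp only [g, G, one_smul, add_sub_cancel, Matrix.of_apply, Matrix.one_apply]
      have : σ i = σ j ↔ i = j := ⟨fun he => by rw [← h.invol i, he, h.invol], fun he => by rw [he]⟩
      simp [this]
    rw [h0, h2] at h1
    simp at h1
  · intro t ht
    rw [hP] at ht
    set F := F₀ + t • G with hFdef
    have hg : g F ∈ incidence K R := by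
      intro i j hij
      simp only [g, Matrix.of_apply] at hij
      split_ifs at hij with h1 h2
      · exact h.full_U _ _ h1.1 h1.2.1
      · exact h2 ▸ h.refl i
      · exact absurd rfl hij
    obtain ⟨k, hk, hkg, hgk⟩ := exists_inverse_mem_incidence h.refl h.trans hg ht
    refine le_trans (h.le_finrank_ker_of_normal_on_matched (k * F * g F) fun u w hu hw hUw => ?_)
      (finrank_ker_relForm_conj_le h.trans hg hk hgk F)
    have hUnw := h.not_U _ hw
    have e1 : (k * F * g F) u w = (k * F) u w := by
      rw [Matrix.mul_apply, Finset.sum_eq_single w]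
      · simp [g, c, hUnw]
      · intro j _ hj
        simp [g, c, hUnw, hj]
      · simp
    -- Column `w` of `F` is column `σ w` of `g F` on the rows in `U`, and row `u` of `k` has no
    -- other nonzero entries.
    have e2 : (k * F) u w = (k * g F) u (σ w) := by
      rw [Matrix.mul_apply, Matrix.mul_apply]
      refine Finset.sum_congr rfl fun j _ => ?_
      by_cases hj : U j
      · have : g F j (σ w) = F j w := by
          simp only [g, c, Matrix.of_apply, h.invol]
          rw [if_pos ⟨hj, hUw, hw⟩]
        rw [this]
      · rw [eq_zero_of_mem_incidence hk fun h' => hj (h.row_U _ _ h' hu), zero_mul, zero_mul]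
    rw [e1, e2, hkg, Matrix.one_apply]
    have : u = σ w ↔ σ u = w := ⟨fun he => by rw [he, h.invol], fun he => by rw [← he, h.invol]⟩
    simp [this]

theorem relIndex_eq (K : Type*) [Field K] [Infinite K] : relIndex K R = relIndex K R' :=
  le_antisymm (h.relIndex_le_relIndex K) h.relIndex_ge_relIndex

end IsFold

end FoldIndex

/-! ### A full matrix block `𝔤𝔩_a` adds `a` to the index. -/

section DirectSum

open Module Matrix

variable {K : Type*} [Field K] {ι ι' : Type*}

instance (R : ι → ι → Prop) (p : Submodule K (incidence K R)) : Module.Free K p := by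
  have := Module.Free.of_divisionRing K p
  exact this

/-- The disjoint union of a complete relation on `Fin a` and a relation `R`. -/
def fullSumRel (a : ℕ) (R : ι → ι → Prop) : Fin a ⊕ ι → Fin a ⊕ ι → Prop :=
  Sum.LiftRel (fun _ _ => True) R

theorem fromBlocks_mem_incidence {a : ℕ} {R : ι → ι → Prop} (A : Matrix (Fin a) (Fin a) K)
    {D : Matrix ι ι K} (hD : D ∈ incidence K R) :
    fromBlocks A 0 0 D ∈ incidence K (fullSumRel a R) := by
  rintro (i | i) (j | j) hij
  · simp [fullSumRel]
  · simp at hij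
  · simp at hij
  · simpa [fullSumRel] using hD i j hij

theorem eq_fromBlocks_of_mem_incidence {a : ℕ} {R : ι → ι → Prop}
    {X : Matrix (Fin a ⊕ ι) (Fin a ⊕ ι) K} (hX : X ∈ incidence K (fullSumRel a R)) :
    X = fromBlocks X.toBlocks₁₁ 0 0 X.toBlocks₂₂ ∧ X.toBlocks₂₂ ∈ incidence K R := by
  constructor
  · ext (i | i) (j | j)
    · rfl
    · exact eq_zero_of_mem_incidence hX (by simp [fullSumRel])
    · exact eq_zero_of_mem_incidence hX (by simp [fullSumRel])
    · rfl
  · intro i j hij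
    have := hX (Sum.inr i) (Sum.inr j) hij
    simpa [fullSumRel] using this

variable [Fintype ι]

/-- An isomorphism of preorders is a fold in which nothing is matched. -/
theorem relIndex_congr [Fintype ι'] (K : Type*) [Field K] [Infinite K] {R : ι → ι → Prop} {R' : ι' → ι' → Prop}
    (hr : ∀ i, R i i) (ht : ∀ i j k, R i j → R j k → R i k) (e : ι ≃ ι')
    (he : ∀ i j, R' (e i) (e j) ↔ R i j) : relIndex K R = relIndex K R' := by
  have h : IsFold R R' (fun _ => False) (fun _ => False) id e :=
    { refl := hr
      trans := ht
      trans' := by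
        intro x y z
        obtain ⟨x, rfl⟩ := e.surjective x
        obtain ⟨y, rfl⟩ := e.surjective y
        obtain ⟨z, rfl⟩ := e.surjective z
        simpa only [he] using ht x y z
      row_U := by simp
      col_U := by simp
      col_W := by simp
      not_U := by simp
      full_WU := by simp
      full_U := by simp
      invol := by simp
      map_eq_iff := by
        intro i j
        simp [eq_comm]
      map_surj := e.surjective
      map_U := by simp
      map_W := by simp
      map_other := by simp
      rel_U := by simp
      rel_not_U := by simp [he]
      rel_lift := fun x y _ => ⟨e.symm x, e.symm y, by simp⟩
      complete := by simp }
  exact h.relIndex_eq K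

theorem fromBlocks_mem_ker_relForm {a : ℕ} {R : ι → ι → Prop}
    (F : Matrix (Fin a ⊕ ι) (Fin a ⊕ ι) K) (X : incidence K (fullSumRel a R))
    (A : Matrix (Fin a) (Fin a) K) (D : incidence K R) (hX : X.1 = fromBlocks A 0 0 D.1) :
    X ∈ LinearMap.ker (relForm (fullSumRel a R) F) ↔
      F.toBlocks₁₁ * A = A * F.toBlocks₁₁ ∧ D ∈ LinearMap.ker (relForm R F.toBlocks₂₂) := by
  have hc : F * X.1 - X.1 * F = fromBlocks (F.toBlocks₁₁ * A - A * F.toBlocks₁₁)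
      (F.toBlocks₁₂ * D.1 - A * F.toBlocks₁₂) (F.toBlocks₂₁ * A - D.1 * F.toBlocks₂₁)
      (F.toBlocks₂₂ * D.1 - D.1 * F.toBlocks₂₂) := by
    rw [hX]
    conv_lhs => rw [← Matrix.fromBlocks_toBlocks F]
    rw [Matrix.fromBlocks_multiply, Matrix.fromBlocks_multiply, sub_eq_add_neg,
      Matrix.fromBlocks_neg, Matrix.fromBlocks_add]
    simp [sub_eq_add_neg]
  rw [mem_ker_relForm, mem_ker_relForm, hc, ← sub_eq_zero]
  constructor
  · intro h
    refine ⟨?_, fun i j hij => h (Sum.inr i) (Sum.inr j) (by simpa [fullSumRel] using hij)⟩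
    ext j i
    exact h (Sum.inl i) (Sum.inl j) (by simp [fullSumRel])
  · rintro ⟨h1, h2⟩ (i | i) (j | j) hij
    · rw [Matrix.fromBlocks_apply₁₁, h1, Matrix.zero_apply]
    · simp [fullSumRel] at hij
    · simp [fullSumRel] at hij
    · exact h2 i j (by simpa [fullSumRel] using hij)

/-- The Krylov matrix of `A` with respect to the all-ones vector. -/
def krylov {S : Type*} [CommRing S] {a : ℕ} (A : Matrix (Fin a) (Fin a) S) :
    Matrix (Fin a) (Fin a) S :=
  Matrix.of fun i k => ((A ^ (k : ℕ)) *ᵥ 1) i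

theorem krylov_diagonal {S : Type*} [CommRing S] {a : ℕ} (d : Fin a → S) :
    krylov (Matrix.diagonal d) = Matrix.vandermonde d := by
  ext i k
  simp [krylov, Matrix.diagonal_pow, Matrix.mulVec_diagonal, Matrix.vandermonde_apply]

theorem map_krylov {S T : Type*} [CommRing S] [CommRing T] {a : ℕ} (f : S →+* T)
    (A : Matrix (Fin a) (Fin a) S) : f.mapMatrix (krylov A) = krylov (f.mapMatrix A) := by
  ext i k
  simp only [krylov, RingHom.mapMatrix_apply, Matrix.map_apply, Matrix.of_apply]
  rw [← RingHom.mapMatrix_apply, ← map_pow, RingHom.map_mulVec]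
  congr 1
  ext
  simp

/-- When the all-ones vector is cyclic for the block `A`, the powers `1, A, …, A^(a-1)` are
independent; they commute with `A`, so they contribute `a` dimensions to the stabilizer. -/
theorem le_finrank_ker_fullSumRel {a : ℕ} {R : ι → ι → Prop}
    (F : Matrix (Fin a ⊕ ι) (Fin a ⊕ ι) K) (hF : (krylov F.toBlocks₁₁).det ≠ 0) :
    a + relIndex K R ≤ finrank K (LinearMap.ker (relForm (fullSumRel a R) F)) := by
  set A := F.toBlocks₁₁
  let p : (Fin a → K) →ₗ[K] Matrix (Fin a) (Fin a) K :=
    Fintype.linearCombination K fun k : Fin a => A ^ (k : ℕ)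
  have hp : ∀ c, p c = ∑ k, c k • A ^ (k : ℕ) := fun c => rfl
  have hcomm : ∀ c, A * p c = p c * A := by
    intro c
    rw [hp, Finset.mul_sum, Finset.sum_mul]
    refine Finset.sum_congr rfl fun k _ => ?_
    rw [Matrix.mul_smul, Matrix.smul_mul, ← pow_succ, ← pow_succ']
  let q : (Fin a → K) × LinearMap.ker (relForm R F.toBlocks₂₂) →ₗ[K]
      incidence K (fullSumRel a R) :=
    { toFun := fun x => ⟨fromBlocks (p x.1) 0 0 x.2.1.1, fromBlocks_mem_incidence _ x.2.1.2⟩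
      map_add' := by
        intro x y
        ext1
        simp [Matrix.fromBlocks_add]
      map_smul' := by
        intro r x
        ext1
        simp [Matrix.fromBlocks_smul] }
  have hq : ∀ x, q x ∈ LinearMap.ker (relForm (fullSumRel a R) F) := fun x =>
    (fromBlocks_mem_ker_relForm F (q x) (p x.1) x.2.1 rfl).2 ⟨hcomm _, x.2.2⟩
  have hinj : Function.Injective (q.codRestrict _ hq) := by
    rintro ⟨c, D⟩ ⟨c', D'⟩ hx
    have h1 : fromBlocks (p c) 0 0 D.1.1 = fromBlocks (p c') 0 0 D'.1.1 :=
      congrArg (fun z : LinearMap.ker (relForm (fullSumRel a R) F) => z.1.1) hx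
    rw [Matrix.fromBlocks_inj] at h1
    have h2 : ∀ c, krylov A *ᵥ c = p c *ᵥ 1 := by
      intro c
      ext i
      simp only [hp, Matrix.sum_mulVec, Finset.sum_apply, Matrix.smul_mulVec, Pi.smul_apply,
        smul_eq_mul]
      rw [Matrix.mulVec, dotProduct]
      exact Finset.sum_congr rfl fun k _ => mul_comm _ _
    have h3 : krylov A *ᵥ (c - c') = 0 := by
      rw [Matrix.mulVec_sub, h2, h2, h1.1, sub_self]
    rw [sub_eq_zero.1 (Matrix.eq_zero_of_mulVec_eq_zero hF h3),
      Subtype.ext (Subtype.ext h1.2.2.2)]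
  have := LinearMap.finrank_le_finrank_of_injective hinj
  rw [Module.finrank_prod, Module.finrank_fin_fun] at this
  exact (Nat.add_le_add_left (relIndex_le R _) a).trans this

/-- A diagonal block with the distinct entries `0, …, a - 1` has only diagonal matrices in its
centralizer. -/
theorem relIndex_fullSumRel_le [CharZero K] (a : ℕ) (R : ι → ι → Prop) :
    relIndex K (fullSumRel a R) ≤ a + relIndex K R := by
  obtain ⟨F', hF'⟩ := exists_relIndex_eq K R
  let d : Fin a → K := fun i => ((i : ℕ) : K)
  let F : Matrix (Fin a ⊕ ι) (Fin a ⊕ ι) K := fromBlocks (Matrix.diagonal d) 0 0 F'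
  let q : LinearMap.ker (relForm (fullSumRel a R) F) →ₗ[K]
      (Fin a → K) × LinearMap.ker (relForm R F') :=
    { toFun := fun X => (X.1.1.toBlocks₁₁.diag, ⟨⟨X.1.1.toBlocks₂₂,
        (eq_fromBlocks_of_mem_incidence X.1.2).2⟩, by
          have := (fromBlocks_mem_ker_relForm F X.1 X.1.1.toBlocks₁₁ ⟨X.1.1.toBlocks₂₂,
            (eq_fromBlocks_of_mem_incidence X.1.2).2⟩
            (eq_fromBlocks_of_mem_incidence X.1.2).1).1 X.2
          simpa [F] using this.2⟩)
      map_add' := fun X Y => rfl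
      map_smul' := fun c X => rfl }
  have hoff : ∀ X : LinearMap.ker (relForm (fullSumRel a R) F),
      X.1.1.toBlocks₁₁ = Matrix.diagonal X.1.1.toBlocks₁₁.diag := by
    intro X
    have h0 := (fromBlocks_mem_ker_relForm F X.1 X.1.1.toBlocks₁₁ ⟨X.1.1.toBlocks₂₂,
      (eq_fromBlocks_of_mem_incidence X.1.2).2⟩ (eq_fromBlocks_of_mem_incidence X.1.2).1).1 X.2
    ext i j
    by_cases hij : i = j
    · subst hij
      simp
    · have h5 := congrFun (congrFun h0.1 i) j
      simp only [F, Matrix.toBlocks_fromBlocks₁₁, Matrix.diagonal_mul, Matrix.mul_diagonal] at h5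
      have h6 : d i - d j ≠ 0 := by
        rw [sub_ne_zero]
        simpa [d, Fin.ext_iff] using hij
      rw [Matrix.diagonal_apply_ne _ hij]
      refine (mul_eq_zero.1 ?_).resolve_left h6
      rw [sub_mul, h5, mul_comm, sub_self]
  have hinj : Function.Injective q := by
    intro X Y hXY
    have h2 : X.1.1.toBlocks₁₁.diag = Y.1.1.toBlocks₁₁.diag := congrArg Prod.fst hXY
    have h3 : X.1.1.toBlocks₂₂ = Y.1.1.toBlocks₂₂ :=
      congrArg (fun z : (Fin a → K) × LinearMap.ker (relForm R F') => z.2.1.1) hXY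
    refine Subtype.ext (Subtype.ext ?_)
    rw [(eq_fromBlocks_of_mem_incidence X.1.2).1, (eq_fromBlocks_of_mem_incidence Y.1.2).1,
      hoff X, hoff Y, h2, h3]
  have := LinearMap.finrank_le_finrank_of_injective hinj
  rw [Module.finrank_prod, Module.finrank_fin_fun, hF'] at this
  exact (relIndex_le _ F).trans this

-- Cyclicity is generic: along the chosen line the Krylov determinant is polynomial, and at `t = 1`
-- it is the Vandermonde determinant of `0, …, a - 1`, nonzero in characteristic 0.
open Polynomial in
theorem relIndex_fullSumRel [CharZero K] (a : ℕ) (R : ι → ι → Prop) :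
    relIndex K (fullSumRel a R) = a + relIndex K R := by
  refine le_antisymm (relIndex_fullSumRel_le a R) (le_relIndex_of_generic _ _ fun F₀ => ?_)
  let d : Fin a → K := fun i => ((i : ℕ) : K)
  let G : Matrix (Fin a ⊕ ι) (Fin a ⊕ ι) K := fromBlocks (Matrix.diagonal d) 0 0 0 - F₀
  let P : K[X] := (krylov (Matrix.of fun i j =>
    C (F₀.toBlocks₁₁ i j) + X * C (G.toBlocks₁₁ i j))).det
  have hP : ∀ t, P.eval t = (krylov (F₀ + t • G).toBlocks₁₁).det := by
    intro t
    rw [← Polynomial.coe_evalRingHom, RingHom.map_det, map_krylov]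
    congr 2
    ext i j
    simp [Matrix.toBlocks₁₁]
    ring
  refine ⟨G, P, ?_, fun t ht => le_finrank_ker_fullSumRel _ (by rwa [← hP])⟩
  intro h0
  have h1 := hP 1
  have h2 : (F₀ + (1 : K) • G).toBlocks₁₁ = Matrix.diagonal d := by
    simp [G]
  rw [h0, h2, krylov_diagonal, Polynomial.eval_zero, eq_comm] at h1
  refine Matrix.det_vandermonde_ne_zero_iff.2 ?_ h1
  intro i j hij
  simpa [d, Fin.ext_iff] using hij

end DirectSum

/-! ### The preorder of a seaweed algebra and its two elementary folds. -/

section SeaweedRelation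

/-- The number of the block containing the position `i`, for the blocks with sizes given by a
list. -/
def blockIndex : List ℕ → ℕ → ℕ
  | [], _ => 0
  | a :: T, i => if i < a then 0 else blockIndex T (i - a) + 1

theorem blockIndex_mono (T : List ℕ) : Monotone (blockIndex T) := by
  induction T with
  | nil => intro i j _; simp [blockIndex]
  | cons a T ih =>
    intro i j hij
    have := ih (Nat.sub_le_sub_right hij a)
    simp only [blockIndex]
    split_ifs <;> omega

/-- Positions `(i, j)` at which a matrix in the seaweed algebra of `T / B` may be nonzero. -/
def seaweedRel (T B : List ℕ) (i j : ℕ) : Prop :=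
  (i < j → blockIndex T i = blockIndex T j) ∧ (j < i → blockIndex B i = blockIndex B j)

theorem blockIndex_cons_eq_iff (a : ℕ) (T : List ℕ) (i j : ℕ) :
    blockIndex (a :: T) i = blockIndex (a :: T) j ↔
      (i < a ∧ j < a) ∨ (a ≤ i ∧ a ≤ j ∧ blockIndex T (i - a) = blockIndex T (j - a)) := by
  simp only [blockIndex]
  grind

theorem seaweedRel_refl (T B : List ℕ) (i : ℕ) : seaweedRel T B i i := by simp [seaweedRel]

theorem seaweedRel_trans (T B : List ℕ) (i j k : ℕ) (h1 : seaweedRel T B i j)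
    (h2 : seaweedRel T B j k) : seaweedRel T B i k := by
  have mT := blockIndex_mono T
  have mB := blockIndex_mono B
  unfold seaweedRel at *
  have a1 := @mT i j
  have a2 := @mT j k
  have a3 := @mT j i
  have a4 := @mT k j
  have b1 := @mB i j
  have b2 := @mB j k
  have b3 := @mB j i
  have b4 := @mB k j
  have a5 := @mT i k
  have a6 := @mT k i
  have b5 := @mB i k
  have b6 := @mB k i
  grind

theorem seaweedRel_swap (T B : List ℕ) (i j : ℕ) : seaweedRel T B i j ↔ seaweedRel B T j i := by
  unfold seaweedRel
  constructor <;> rintro ⟨h1, h2⟩ <;> exact ⟨fun h => (h2 h).symm, fun h => (h1 h).symm⟩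

/-- Shifting by `b - a` matches the last `b - a` positions of `U` with all of `W`; gluing them
leaves `U` as the new first lower block. -/
theorem isFold_seaweedRel_of_le_two_mul {n a b : ℕ} (T B : List ℕ) (hab : a < b) (h2 : b ≤ 2 * a)
    (hbn : b ≤ n) :
    IsFold (fun i j : Fin n => seaweedRel (a :: T) (b :: B) i j)
      (fun i j : Fin (n - (b - a)) => seaweedRel ((2 * a - b) :: T) (a :: B) i j)
      (fun i => (i : ℕ) < a) (fun i => a ≤ (i : ℕ) ∧ (i : ℕ) < b)
      (fun i => if _ : (i : ℕ) < a then (if _ : a ≤ i + (b - a) then ⟨i + (b - a), by omega⟩ else i)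
        else if (i : ℕ) < b then ⟨i - (b - a), by omega⟩ else i)
      (fun i => if h : (i : ℕ) < a then ⟨i, by omega⟩ else ⟨i - (b - a), by omega⟩) where
  refl i := seaweedRel_refl _ _ _
  trans i j k := seaweedRel_trans _ _ _ _ _
  trans' i j k := seaweedRel_trans _ _ _ _ _
  row_U := by
    intro i j
    simp only [seaweedRel, blockIndex_cons_eq_iff]
    grind
  col_U := by
    intro i j
    simp only [seaweedRel, blockIndex_cons_eq_iff]
    grind
  col_W := by
    intro i j
    simp only [seaweedRel, blockIndex_cons_eq_iff]
    grind
  not_U := by omega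
  full_WU := by
    intro i j
    simp only [seaweedRel, blockIndex_cons_eq_iff]
    grind
  full_U := by
    intro i j
    simp only [seaweedRel, blockIndex_cons_eq_iff]
    grind
  invol := by
    intro i
    grind
  map_eq_iff := by
    intro i j
    grind
  map_surj := by
    intro x
    by_cases h : (x : ℕ) < a
    · exact ⟨⟨x, by omega⟩, by simp [h]⟩
    · refine ⟨⟨x + (b - a), by omega⟩, ?_⟩
      grind
  map_U := by
    grind
  map_W := by
    grind
  map_other := by
    grind
  rel_U := by
    intro i j hi hj
    simp only [seaweedRel, blockIndex_cons_eq_iff]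
    grind
  rel_not_U := by
    intro i j hi hj
    simp only [seaweedRel, blockIndex_cons_eq_iff]
    grind
  rel_lift := by
    intro x y
    simp only [seaweedRel, blockIndex_cons_eq_iff]
    intro hR
    by_cases hU : (x : ℕ) < a ∧ (y : ℕ) < a
    · exact ⟨⟨x, by omega⟩, ⟨y, by omega⟩, by grind, by grind, by grind⟩
    · exact ⟨⟨x + (b - a), by omega⟩, ⟨y + (b - a), by omega⟩, by grind, by grind, by grind⟩
  complete := by
    right
    grind

/-- Shifting by `b - a` matches all of `U` with the last `a` positions of the lower block. The `b -
2 * a` unmatched positions of `W` become a first lower block of their own, which may be empty. -/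
theorem isFold_seaweedRel_of_two_mul_le {n a b : ℕ} (T B : List ℕ) (hab : a < b) (h2 : 2 * a ≤ b)
    (hbn : b ≤ n) :
    IsFold (fun i j : Fin n => seaweedRel (a :: T) (b :: B) i j)
      (fun i j : Fin (n - a) => seaweedRel T ((b - 2 * a) :: a :: B) i j)
      (fun i => (i : ℕ) < a) (fun i => a ≤ (i : ℕ) ∧ (i : ℕ) < b)
      (fun i => if _ : (i : ℕ) < a then ⟨i + (b - a), by omega⟩
        else if b - a ≤ (i : ℕ) ∧ (i : ℕ) < b then ⟨i - (b - a), by omega⟩ else i)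
      (fun i => if h : (i : ℕ) < a then ⟨i + (b - 2 * a), by omega⟩ else ⟨i - a, by omega⟩) where
  refl i := seaweedRel_refl _ _ _
  trans i j k := seaweedRel_trans _ _ _ _ _
  trans' i j k := seaweedRel_trans _ _ _ _ _
  row_U := by
    intro i j
    simp only [seaweedRel, blockIndex_cons_eq_iff]
    grind
  col_U := by
    intro i j
    simp only [seaweedRel, blockIndex_cons_eq_iff]
    grind
  col_W := by
    intro i j
    simp only [seaweedRel, blockIndex_cons_eq_iff]
    grind
  not_U := by omega
  full_WU := by
    intro i j
    simp only [seaweedRel, blockIndex_cons_eq_iff]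
    grind
  full_U := by
    intro i j
    simp only [seaweedRel, blockIndex_cons_eq_iff]
    grind
  invol := by
    intro i
    grind
  map_eq_iff := by
    intro i j
    grind
  map_surj := by
    intro x
    exact ⟨⟨x + a, by omega⟩, by grind⟩
  map_U := by
    grind
  map_W := by
    grind
  map_other := by
    grind
  rel_U := by
    intro i j hi hj
    have ei : (i : ℕ) + (b - a) - a = i + (b - 2 * a) := by omega
    have ej : (j : ℕ) + (b - a) - a = j + (b - 2 * a) := by omega
    simp only [seaweedRel, blockIndex_cons_eq_iff, dif_pos hi, dif_pos hj, ei, ej]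
    omega
  rel_not_U := by
    intro i j hi hj
    simp only [seaweedRel, blockIndex_cons_eq_iff]
    grind
  rel_lift := by
    intro x y
    exact fun _ => ⟨⟨x + a, by omega⟩, ⟨y + a, by omega⟩, by grind, by grind, by grind⟩
  complete := by
    left
    simp only [seaweedRel, blockIndex_cons_eq_iff]
    grind

end SeaweedRelation

/-! ### The index of a seaweed algebra by reduction of first parts. -/

section SeaweedIndex

open Module Matrix

/-- Transposition sends the stabilizer of `Fᵀ` to that of `F`, as it reverses commutators up to
sign. -/
theorem relIndex_flip_le (K : Type*) [Field K] {ι : Type*} [Fintype ι] (R : ι → ι → Prop) :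
    relIndex K (fun i j => R j i) ≤ relIndex K R := by
  obtain ⟨F, hF⟩ := exists_relIndex_eq K R
  rw [← hF]
  refine (relIndex_le _ Fᵀ).trans ?_
  let q : LinearMap.ker (relForm (fun i j => R j i) Fᵀ) →ₗ[K] LinearMap.ker (relForm R F) :=
    { toFun := fun X => ⟨⟨X.1.1ᵀ, fun i j hij => X.1.2 j i hij⟩, by
        rw [mem_ker_relForm]
        intro i j hij
        have h1 := mem_ker_relForm.1 X.2 j i hij
        have h2 : F * X.1.1ᵀ - X.1.1ᵀ * F = -(Fᵀ * X.1.1 - X.1.1 * Fᵀ)ᵀ := by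
          simp [Matrix.transpose_sub, Matrix.transpose_mul]
        rw [h2, Matrix.neg_apply, Matrix.transpose_apply, h1, neg_zero]⟩
      map_add' := fun X Y => rfl
      map_smul' := fun c X => rfl }
  refine LinearMap.finrank_le_finrank_of_injective (f := q) fun X Y h => ?_
  have h1 : X.1.1ᵀ = Y.1.1ᵀ := congrArg (fun z : LinearMap.ker (relForm R F) => z.1.1) h
  exact Subtype.ext (Subtype.ext (Matrix.transpose_injective h1))

theorem relIndex_seaweedRel_swap (K : Type*) [Field K] (n : ℕ) (T B : List ℕ) :
    relIndex K (fun i j : Fin n => seaweedRel T B i j) =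
      relIndex K (fun i j : Fin n => seaweedRel B T i j) := by
  have h : ∀ T B : List ℕ, relIndex K (fun i j : Fin n => seaweedRel T B i j) ≤
      relIndex K (fun i j : Fin n => seaweedRel B T i j) := by
    intro T B
    refine le_trans (le_of_eq ?_) (relIndex_flip_le K _)
    congr 1
    funext i j
    exact propext (seaweedRel_swap T B i j)
  exact le_antisymm (h T B) (h B T)

theorem relIndex_seaweedRel_cons_self (K : Type*) [Field K] [CharZero K] (m a : ℕ)
    (T B : List ℕ) :
    relIndex K (fun i j : Fin (a + m) => seaweedRel (a :: T) (a :: B) i j) =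
      a + relIndex K (fun i j : Fin m => seaweedRel T B i j) := by
  rw [← relIndex_fullSumRel]
  refine relIndex_congr K (fun i => seaweedRel_refl _ _ _)
    (fun i j k => seaweedRel_trans _ _ _ _ _) finSumFinEquiv.symm fun i j => ?_
  obtain ⟨i, rfl⟩ := finSumFinEquiv.surjective i
  obtain ⟨j, rfl⟩ := finSumFinEquiv.surjective j
  rw [Equiv.symm_apply_apply, Equiv.symm_apply_apply]
  rcases i with i | i <;> rcases j with j | j <;>
    simp only [fullSumRel, seaweedRel, blockIndex_cons_eq_iff, finSumFinEquiv_apply_left,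
      finSumFinEquiv_apply_right, Fin.val_castAdd, Fin.val_natAdd, Sum.liftRel_inl_inl,
      Sum.liftRel_inr_inr, Sum.not_liftRel_inl_inr, Sum.not_liftRel_inr_inl,
      Nat.add_sub_cancel_left] <;> grind

theorem seaweedRel_zero_cons_left (T B : List ℕ) (i j : ℕ) :
    seaweedRel (0 :: T) B i j ↔ seaweedRel T B i j := by
  simp [seaweedRel, blockIndex_cons_eq_iff]

theorem seaweedRel_zero_cons_right (T B : List ℕ) (i j : ℕ) :
    seaweedRel T (0 :: B) i j ↔ seaweedRel T B i j := by
  simp [seaweedRel, blockIndex_cons_eq_iff]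

/-- The index of the meander with upper and lower parts given by two lists, computed by the
reductions of the first parts. -/
def redIndex : List ℕ → List ℕ → ℕ
  | [], _ => 0
  -- For lists of equal sum this occurs only when all remaining upper parts are 0, so the value is
  -- correct. Zero parts come from `2 * a = b` or `2 * b = a`.
  | _ :: _, [] => 0
  | a :: T, b :: B =>
    if a = 0 then redIndex T (b :: B)
    else if b = 0 then redIndex (a :: T) B
    else if a = b then a + redIndex T B
    else if a < b then
      if 2 * a ≤ b then redIndex T ((b - 2 * a) :: a :: B)
      else redIndex ((2 * a - b) :: T) (a :: B)
    else
      if 2 * b ≤ a then redIndex ((a - 2 * b) :: b :: T) B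
      else redIndex (b :: T) ((2 * b - a) :: B)
  termination_by T B => T.sum + B.sum + T.length + B.length
  decreasing_by all_goals simp only [List.sum_cons, List.length_cons]; omega

theorem relIndex_of_isEmpty (K : Type*) [Field K] {ι : Type*} [Fintype ι] [IsEmpty ι]
    (R : ι → ι → Prop) : relIndex K R = 0 := by
  refine Nat.le_zero.1 ((relIndex_le R 0).trans (le_of_eq ?_))
  have : Subsingleton (LinearMap.ker (relForm R (0 : Matrix ι ι K))) :=
    ⟨fun X Y => Subtype.ext (Subtype.ext (Subsingleton.elim _ _))⟩
  exact Module.finrank_zero_of_subsingleton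

theorem relIndex_seaweedRel (K : Type*) [Field K] [CharZero K] (T B : List ℕ) :
    ∀ n : ℕ, T.sum = n → B.sum = n →
      relIndex K (fun i j : Fin n => seaweedRel T B i j) = redIndex T B := by
  induction T, B using redIndex.induct with
  | case1 B =>
    intro n h1 _
    simp only [List.sum_nil] at h1
    subst h1
    rw [redIndex, relIndex_of_isEmpty]
  | case2 a T =>
    intro n _ h1
    simp only [List.sum_nil] at h1
    subst h1
    rw [redIndex, relIndex_of_isEmpty]
  | case3 T b B ih =>
    intro n h1 h2
    rw [redIndex, if_pos rfl, ← ih n (by simpa using h1) h2]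
    simp only [seaweedRel_zero_cons_left]
  | case4 a T B ha ih =>
    intro n h1 h2
    rw [redIndex, if_neg ha, if_pos rfl, ← ih n h1 (by simpa using h2)]
    simp only [seaweedRel_zero_cons_right]
  | case5 T b B hb _ ih =>
    intro n h1 h2
    simp only [List.sum_cons] at h1 h2
    obtain rfl : n = b + T.sum := h1.symm
    rw [redIndex, if_neg hb, if_neg hb, if_pos rfl, relIndex_seaweedRel_cons_self,
      ih _ rfl (by omega)]
  | case6 a T b B ha hb hab hlt h2a ih =>
    intro n h1 h2
    rw [redIndex, if_neg ha, if_neg hb, if_neg hab, if_pos hlt, if_pos h2a]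
    simp only [List.sum_cons] at h1 h2 ih
    rw [← ih (n - a) (by omega) (by omega)]
    exact (isFold_seaweedRel_of_two_mul_le T B hlt h2a (by omega)).relIndex_eq K
  | case7 a T b B ha hb hab hlt h2a ih =>
    intro n h1 h2
    rw [redIndex, if_neg ha, if_neg hb, if_neg hab, if_pos hlt, if_neg h2a]
    simp only [List.sum_cons] at h1 h2 ih
    rw [← ih (n - (b - a)) (by omega) (by omega)]
    exact (isFold_seaweedRel_of_le_two_mul T B hlt (by omega) (by omega)).relIndex_eq K
  | case8 a T b B ha hb hab hlt h2b ih =>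
    intro n h1 h2
    rw [redIndex, if_neg ha, if_neg hb, if_neg hab, if_neg hlt, if_pos h2b]
    simp only [List.sum_cons] at h1 h2 ih
    rw [← ih (n - b) (by omega) (by omega), relIndex_seaweedRel_swap,
      relIndex_seaweedRel_swap K (n - b)]
    exact (isFold_seaweedRel_of_two_mul_le B T (by omega) h2b (by omega)).relIndex_eq K
  | case9 a T b B ha hb hab hlt h2b ih =>
    intro n h1 h2
    rw [redIndex, if_neg ha, if_neg hb, if_neg hab, if_neg hlt, if_neg h2b]
    simp only [List.sum_cons] at h1 h2 ih
    rw [← ih (n - (a - b)) (by omega) (by omega), relIndex_seaweedRel_swap,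
      relIndex_seaweedRel_swap K (n - (a - b))]
    exact (isFold_seaweedRel_of_le_two_mul B T (by omega) (by omega) (by omega)).relIndex_eq K

/-- The symmetry is inherited from transposition of seaweed algebras over `ℚ`; no induction on lists
is needed. -/
theorem redIndex_swap (T B : List ℕ) (h : T.sum = B.sum) : redIndex T B = redIndex B T := by
  rw [← relIndex_seaweedRel ℚ T B _ rfl h.symm, ← relIndex_seaweedRel ℚ B T _ h.symm rfl,
    relIndex_seaweedRel_swap]

theorem blockIndex_eq_of_sum_take (T : List ℕ) (k j : ℕ) (h1 : (T.take k).sum ≤ j)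
    (h2 : j < (T.take (k + 1)).sum) : blockIndex T j = k := by
  induction T generalizing k j with
  | nil => simp at h2
  | cons a T ih =>
    rw [blockIndex]
    rcases k with _ | k
    · rw [if_pos (by simpa using h2)]
    · simp only [List.take_succ_cons, List.sum_cons] at h1 h2
      rw [if_neg (by omega), ih k (j - a) (by omega)]
      omega

theorem composition_index_eq_blockIndex {n : ℕ} (c : Composition n) (j : Fin n) :
    (c.index j : ℕ) = blockIndex c.blocks j :=
  (blockIndex_eq_of_sum_take _ _ _ (c.sizeUpTo_index_le j) (c.lt_sizeUpTo_index_succ j)).symm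

theorem mem_seaweed_iff {K : Type*} [Field K] {n : ℕ} (lam mu : Composition n)
    (A : Matrix (Fin n) (Fin n) K) :
    A ∈ seaweed K lam mu ↔
      A ∈ incidence K (fun i j : Fin n => seaweedRel lam.blocks mu.blocks i j) := by
  change (∀ i j, A i j ≠ 0 → _) ↔ ∀ i j, A i j ≠ 0 → _
  simp only [Fin.ext_iff, composition_index_eq_blockIndex, seaweedRel, Fin.lt_def]

/-- Every linear form on the seaweed algebra extends to all matrices and is then a trace form, so
both minima run over the same dimensions. -/
theorem lieIndex_seaweed (K : Type*) [Field K] {n : ℕ} (lam mu : Composition n) :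
    lieIndex K (seaweed K lam mu) =
      relIndex K (fun i j : Fin n => seaweedRel lam.blocks mu.blocks i j) := by
  set R := fun i j : Fin n => seaweedRel lam.blocks mu.blocks i j
  let e : seaweed K lam mu ≃ₗ[K] incidence K R :=
    { toFun := fun x => ⟨x.1, (mem_seaweed_iff lam mu x.1).1 x.2⟩
      invFun := fun x => ⟨x.1, (mem_seaweed_iff lam mu x.1).2 x.2⟩
      map_add' := fun x y => rfl
      map_smul' := fun c x => rfl
      left_inv := fun x => rfl
      right_inv := fun x => rfl }
  have key : ∀ (f : Module.Dual K (seaweed K lam mu)) (F : Matrix (Fin n) (Fin n) K),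
      (∀ x, f x = trace (F * x.1)) → finrank K (coadjointStabilizer K (seaweed K lam mu) f) =
        finrank K (LinearMap.ker (relForm R F)) := by
    intro f F hf
    have hmap : LinearMap.ker (relForm R F)
        = (coadjointStabilizer K (seaweed K lam mu) f).map e.toLinearMap := by
      ext x
      rw [Submodule.mem_map, LinearMap.mem_ker]
      constructor
      · intro hx
        refine ⟨e.symm x, fun y => ?_, rfl⟩
        have h1 := LinearMap.congr_fun hx (e y)
        rw [hf]
        exact h1
      · rintro ⟨y, hy, rfl⟩
        ext z
        have h1 := hy (e.symm z)
        rw [hf] at h1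
        exact h1
    rw [hmap]
    exact (Submodule.equivMapOfInjective e.toLinearMap e.injective _).finrank_eq
  unfold lieIndex relIndex
  congr 1
  ext d
  constructor
  · rintro ⟨f, rfl⟩
    obtain ⟨g, hg⟩ := LinearMap.exists_extend (p := incidence K R) (f ∘ₗ e.symm.toLinearMap)
    obtain ⟨F, hF⟩ := exists_trace_mul_eq g
    refine ⟨F, (key f F fun x => ?_).symm⟩
    rw [← hF]
    have := LinearMap.congr_fun hg (e x)
    exact this.symm
  · rintro ⟨F, rfl⟩
    exact ⟨(Matrix.traceLinearMap (Fin n) K K ∘ₗ LinearMap.mulLeft K F) ∘ₗ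
      (incidence K R).subtype ∘ₗ e.toLinearMap, key _ F fun x => rfl⟩

theorem Meander.ind_eq_redIndex (K : Type*) [Field K] [CharZero K] {n : ℕ} (M : Meander n) :
    M.ind K = redIndex M.top.blocks M.bot.blocks := by
  rw [Meander.ind, lieIndex_seaweed,
    relIndex_seaweedRel K _ _ n M.top.blocks_sum M.bot.blocks_sum]

end SeaweedIndex

/-! ### Generating functions of completions, and reading one part. -/

section GeneratingFunctions

/-- The exponent of the monomial `x ^ n y ^ k`. -/
noncomputable def expo (n k : ℕ) : Fin 2 →₀ ℕ := Finsupp.single 0 n + Finsupp.single 1 k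

@[simp] theorem expo_zero_apply (n k : ℕ) : expo n k 0 = n := by simp [expo]

@[simp] theorem expo_one_apply (n k : ℕ) : expo n k 1 = k := by simp [expo]

theorem eq_expo_iff (m : Fin 2 →₀ ℕ) (n k : ℕ) : expo n k = m ↔ n = m 0 ∧ k = m 1 := by
  constructor
  · rintro rfl
    simp
  · rintro ⟨rfl, rfl⟩
    ext i
    fin_cases i <;> simp

theorem expo_add (n k n' k' : ℕ) : expo (n + n') (k + k') = expo n k + expo n' k' := by
  rw [eq_expo_iff]
  simp

theorem X_pow_mul_X_pow_eq_monomial (n k : ℕ) :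
    (MvPowerSeries.X 0 : MvPowerSeries (Fin 2) ℚ) ^ n * MvPowerSeries.X 1 ^ k =
      MvPowerSeries.monomial (expo n k) 1 := by
  rw [MvPowerSeries.X_pow_eq, MvPowerSeries.X_pow_eq, MvPowerSeries.monomial_mul_monomial, mul_one,
    expo]

/-- The generating function of a set of weighted objects. -/
noncomputable def genFun {α : Type*} (S : Set α) (w : α → Fin 2 →₀ ℕ) :
    MvPowerSeries (Fin 2) ℚ :=
  fun m => ({a ∈ S | w a = m}.ncard : ℚ)

theorem coeff_genFun {α : Type*} (S : Set α) (w : α → Fin 2 →₀ ℕ) (m : Fin 2 →₀ ℕ) :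
    MvPowerSeries.coeff m (genFun S w) = ({a ∈ S | w a = m}.ncard : ℚ) := rfl

theorem genFun_congr {α : Type*} {S S' : Set α} {w w' : α → Fin 2 →₀ ℕ} (hS : S = S')
    (hw : ∀ a ∈ S', w a = w' a) : genFun S w = genFun S' w' := by
  subst hS
  ext m
  rw [coeff_genFun, coeff_genFun]
  congr 2
  ext a
  constructor
  · rintro ⟨h1, h2⟩
    exact ⟨h1, by rw [← hw a h1, h2]⟩
  · rintro ⟨h1, h2⟩
    exact ⟨h1, by rw [hw a h1, h2]⟩

/-- Finiteness matters because `Set.ncard` is 0 on infinite sets. -/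
theorem genFun_union {α : Type*} {S S' : Set α} {w : α → Fin 2 →₀ ℕ} (hd : Disjoint S S')
    (hS : ∀ m, {a ∈ S | w a = m}.Finite) (hS' : ∀ m, {a ∈ S' | w a = m}.Finite) :
    genFun (S ∪ S') w = genFun S w + genFun S' w := by
  ext m
  rw [map_add, coeff_genFun, coeff_genFun, coeff_genFun, ← Nat.cast_add,
    ← Set.ncard_union_eq _ (hS m) (hS' m)]
  · congr 2
    ext a
    simp only [Set.mem_union, Set.mem_ofPred_eq]
    tauto
  · exact hd.mono (fun a h => h.1) (fun a h => h.1)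

theorem genFun_image {α β : Type*} {S : Set β} {φ : β → α} (hφ : Function.Injective φ)
    {w : α → Fin 2 →₀ ℕ} {w' : β → Fin 2 →₀ ℕ} (n k : ℕ)
    (hw : ∀ b ∈ S, w (φ b) = expo n k + w' b) :
    genFun (φ '' S) w = MvPowerSeries.X 0 ^ n * MvPowerSeries.X 1 ^ k * genFun S w' := by
  classical
  rw [X_pow_mul_X_pow_eq_monomial]
  ext m
  rw [MvPowerSeries.coeff_monomial_mul, coeff_genFun, coeff_genFun]
  split_ifs with hm
  · rw [one_mul, ← Set.ncard_image_of_injective _ hφ]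
    congr 2
    ext a
    constructor
    · rintro ⟨⟨b, hb, rfl⟩, h⟩
      refine ⟨b, ⟨hb, ?_⟩, rfl⟩
      rw [← h, hw b hb, add_tsub_cancel_left]
    · rintro ⟨b, ⟨hb, h⟩, rfl⟩
      refine ⟨⟨b, hb, rfl⟩, ?_⟩
      rw [hw b hb, h, add_tsub_cancel_of_le hm]
  · have : {a ∈ φ '' S | w a = m} = ∅ := by
      rw [Set.eq_empty_iff_forall_notMem]
      rintro _ ⟨⟨b, hb, rfl⟩, h⟩
      refine hm ?_
      rw [← h, hw b hb]
      exact le_self_add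
    rw [this]
    simp

theorem finite_setOf_positive_sum_le (N : ℕ) :
    {l : List ℕ | (∀ x ∈ l, 0 < x) ∧ l.sum ≤ N}.Finite := by
  have h : {l : List ℕ | (∀ x ∈ l, 0 < x) ∧ l.sum ≤ N} ⊆
      ⋃ n ∈ Finset.range (N + 1), Set.range fun c : Composition n => c.blocks := by
    rintro l ⟨h1, h2⟩
    simp only [Finset.mem_range, Set.mem_iUnion, Set.mem_range]
    exact ⟨l.sum, by omega, ⟨l, fun {i} hi => h1 i hi, rfl⟩, rfl⟩
  refine Set.Finite.subset ?_ h
  exact Set.Finite.biUnion (Finset.finite_toSet _) fun n _ => Set.finite_range _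

/-- The pairs of lists with entries in `J` and sums that differ by `s`. -/
def listPairs (J : Set ℕ) (s : ℕ) : Set (List ℕ × List ℕ) :=
  {p | (∀ x ∈ p.1, x ∈ J) ∧ (∀ x ∈ p.2, x ∈ J) ∧ p.1.sum = s + p.2.sum}

/-- The weight of a completion `p` of a meander whose reduction starts with the lower parts `c`. -/
noncomputable def completionWeight (c : List ℕ) (p : List ℕ × List ℕ) : Fin 2 →₀ ℕ :=
  expo p.1.sum (redIndex p.1 (c ++ p.2))

theorem finite_completions {J : Set ℕ} (hJ : 0 ∉ J) (s : ℕ) (c : List ℕ)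
    {S : Set (List ℕ × List ℕ)} (hS : S ⊆ listPairs J s) (m : Fin 2 →₀ ℕ) :
    {p ∈ S | completionWeight c p = m}.Finite := by
  refine ((finite_setOf_positive_sum_le (m 0)).prod (finite_setOf_positive_sum_le (m 0))).subset ?_
  rintro p ⟨hp, hw⟩
  obtain ⟨h1, h2, h3⟩ := hS hp
  have h4 := ((eq_expo_iff _ _ _).1 hw).1
  have hpos : ∀ x ∈ J, 0 < x := fun x hx => Nat.pos_of_ne_zero fun h => hJ (h ▸ hx)
  exact ⟨⟨fun x hx => hpos x (h1 x hx), by omega⟩, ⟨fun x hx => hpos x (h2 x hx), by omega⟩⟩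

/-- A family of properties of completions that is compatible with reading the next part: `Q s T B`
refers to upper parts `T` and lower parts `B` that remain when the lower side is `s` ahead. -/
structure IsReadable (Q : ℕ → List ℕ → List ℕ → Prop) : Prop where
  of_le : ∀ s p T B, 0 < p → p ≤ s → (Q s (p :: T) B ↔ Q (s - p) T B)
  of_lt : ∀ s p T B, 0 < s → s < p → (Q s (p :: T) B ↔ Q (p - s) B T)

/-- The generating function of the completions with property `Q` of a meander whose reduction
starts with the lower parts `c`. -/
noncomputable def completionGenFun (Q : ℕ → List ℕ → List ℕ → Prop) (c : List ℕ) :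
    MvPowerSeries (Fin 2) ℚ :=
  genFun {p ∈ listPairs {1, 7} c.sum | Q c.sum p.1 p.2} (completionWeight c)

theorem zero_notMem_one_seven : (0 : ℕ) ∉ ({1, 7} : Set ℕ) := by simp

variable {Q : ℕ → List ℕ → List ℕ → Prop}

/-- A part 1 shortens the lead of the lower side; a part 7 overshoots it, so the two sides exchange
roles and the lead becomes `7 - s`. -/
theorem completions_eq_union (hQ : IsReadable Q) {s s₁ s₇ : ℕ} (hs : 0 < s) (hs' : s < 7)
    (h1 : s₁ + 1 = s) (h7 : s₇ + s = 7) :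
    {p ∈ listPairs {1, 7} s | Q s p.1 p.2} =
      (fun p : List ℕ × List ℕ => (1 :: p.1, p.2)) '' {p ∈ listPairs {1, 7} s₁ | Q s₁ p.1 p.2} ∪
      (fun p : List ℕ × List ℕ => (7 :: p.2, p.1)) ''
        {p ∈ listPairs {1, 7} s₇ | Q s₇ p.1 p.2} := by
  have e1 : s - 1 = s₁ := by omega
  have e7 : 7 - s = s₇ := by omega
  ext ⟨T, B⟩
  constructor
  · rintro ⟨⟨hT, hB, hsum⟩, hq⟩
    rcases T with _ | ⟨x, T⟩
    · simp only [List.sum_nil] at hsum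
      omega
    simp only [List.mem_cons, forall_eq_or_imp, List.sum_cons] at hT hB hsum hq
    obtain ⟨rfl | rfl, hT⟩ := hT
    · left
      rw [hQ.of_le _ _ _ _ one_pos hs, e1] at hq
      exact ⟨(T, B), ⟨⟨hT, hB, by simp only; omega⟩, hq⟩, rfl⟩
    · right
      rw [hQ.of_lt _ _ _ _ hs hs', e7] at hq
      exact ⟨(B, T), ⟨⟨hB, hT, by simp only; omega⟩, hq⟩, rfl⟩
  · rintro (⟨⟨T', B'⟩, ⟨⟨hT, hB, hsum⟩, hq⟩, he⟩ | ⟨⟨T', B'⟩, ⟨⟨hT, hB, hsum⟩, hq⟩, he⟩)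
    · obtain ⟨rfl, rfl⟩ := Prod.mk.inj he
      refine ⟨⟨?_, hB, ?_⟩, ?_⟩
      · simpa using hT
      · simp only [List.sum_cons] at hsum ⊢
        omega
      · simp only
        rwa [hQ.of_le _ _ _ _ one_pos hs, e1]
    · obtain ⟨rfl, rfl⟩ := Prod.mk.inj he
      refine ⟨⟨?_, hT, ?_⟩, ?_⟩
      · simpa using hB
      · simp only [List.sum_cons] at hsum ⊢
        omega
      · simp only
        rwa [hQ.of_lt _ _ _ _ hs hs', e7]

/-- The weight records the upper sum. After a 7 the old lower side becomes the upper one, whose sum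
is smaller by `s`; this explains the factor `x ^ s`. -/
theorem completionGenFun_eq (hQ : IsReadable Q) (c c₁ c₇ : List ℕ) (k₁ k₇ s : ℕ)
    (hs : c.sum = s) (hs0 : 0 < s) (hs7 : s < 7) (hc₁ : c₁.sum + 1 = s) (hc₇ : c₇.sum + s = 7)
    (h1 : ∀ T B, redIndex (1 :: T) (c ++ B) = k₁ + redIndex T (c₁ ++ B))
    (h7 : ∀ T B, redIndex (7 :: T) (c ++ B) = k₇ + redIndex (c₇ ++ T) B) :
    completionGenFun Q c =
      MvPowerSeries.X 0 ^ 1 * MvPowerSeries.X 1 ^ k₁ * completionGenFun Q c₁ +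
      MvPowerSeries.X 0 ^ s * MvPowerSeries.X 1 ^ k₇ * completionGenFun Q c₇ := by
  subst hs
  have hu := completions_eq_union hQ hs0 hs7 hc₁ hc₇
  have hsub : {p ∈ listPairs {1, 7} c.sum | Q c.sum p.1 p.2} ⊆ listPairs {1, 7} c.sum :=
    fun p hp => hp.1
  unfold completionGenFun
  rw [hu] at hsub ⊢
  rw [genFun_union, genFun_image _ 1 k₁, genFun_image _ c.sum k₇]
  · rintro ⟨T, B⟩ ⟨⟨-, -, hsum⟩, -⟩
    simp only at hsum
    rw [completionWeight, completionWeight, ← expo_add, h7,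
      redIndex_swap (c₇ ++ B) T (by simp only [List.sum_append]; omega)]
    congr 1
    simp only [List.sum_cons]
    omega
  · intro p q h
    simp only [Prod.mk.injEq, List.cons.injEq, true_and] at h
    exact Prod.ext h.2 h.1
  · rintro ⟨T, B⟩ ⟨⟨-, -, hsum⟩, -⟩
    rw [completionWeight, completionWeight, ← expo_add, h1]
    rfl
  · intro p q h
    simp only [Prod.mk.injEq, List.cons.injEq, true_and] at h
    exact Prod.ext h.1 h.2
  · rw [Set.disjoint_left]
    rintro _ ⟨p, -, rfl⟩ ⟨q, -, h⟩
    simp at h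
  · exact finite_completions zero_notMem_one_seven _ _ (Set.subset_union_left.trans hsub)
  · exact finite_completions zero_notMem_one_seven _ _ (Set.subset_union_right.trans hsub)

end GeneratingFunctions

/-! ### The linear system for the parts 1 and 7. -/

section Counting

variable {Q : ℕ → List ℕ → List ℕ → Prop}

theorem completions_seven_eq_union (hQ : IsReadable Q) :
    {p ∈ listPairs {1, 7} 7 | Q 7 p.1 p.2} =
      (fun p : List ℕ × List ℕ => (1 :: p.1, p.2)) '' {p ∈ listPairs {1, 7} 6 | Q 6 p.1 p.2} ∪
      (fun p : List ℕ × List ℕ => (7 :: p.1, p.2)) ''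
        {p ∈ listPairs {1, 7} 0 | Q 0 p.1 p.2} := by
  ext ⟨T, B⟩
  constructor
  · rintro ⟨⟨hT, hB, hsum⟩, hq⟩
    rcases T with _ | ⟨x, T⟩
    · simp only [List.sum_nil] at hsum
      omega
    simp only [List.mem_cons, forall_eq_or_imp, List.sum_cons] at hT hB hsum hq
    obtain ⟨rfl | rfl, hT⟩ := hT
    · left
      rw [hQ.of_le _ _ _ _ one_pos (by norm_num)] at hq
      exact ⟨(T, B), ⟨⟨hT, hB, by simp only; omega⟩, hq⟩, rfl⟩
    · right
      rw [hQ.of_le _ _ _ _ (by norm_num) le_rfl] at hq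
      exact ⟨(T, B), ⟨⟨hT, hB, by simp only; omega⟩, hq⟩, rfl⟩
  · rintro (⟨⟨T', B'⟩, ⟨⟨hT, hB, hsum⟩, hq⟩, he⟩ | ⟨⟨T', B'⟩, ⟨⟨hT, hB, hsum⟩, hq⟩, he⟩)
    · obtain ⟨rfl, rfl⟩ := Prod.mk.inj he
      refine ⟨⟨?_, hB, ?_⟩, ?_⟩
      · simpa using hT
      · simp only [List.sum_cons] at hsum ⊢
        omega
      · simp only
        rwa [hQ.of_le _ _ _ _ one_pos (by norm_num)]
    · obtain ⟨rfl, rfl⟩ := Prod.mk.inj he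
      refine ⟨⟨?_, hB, ?_⟩, ?_⟩
      · simpa using hT
      · simp only [List.sum_cons] at hsum ⊢
        omega
      · simp only
        rwa [hQ.of_le _ _ _ _ (by norm_num) le_rfl]

/-- A lead of 7 is closed exactly by a part 7, so the sides are not exchanged; the pair 7 over 7
contributes index 7. -/
theorem completionGenFun_seven (hQ : IsReadable Q) :
    completionGenFun Q [7] =
      MvPowerSeries.X 0 ^ 1 * MvPowerSeries.X 1 ^ 0 * completionGenFun Q [5, 1] +
      MvPowerSeries.X 0 ^ 7 * MvPowerSeries.X 1 ^ 7 * completionGenFun Q [] := by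
  have hu := completions_seven_eq_union hQ
  have hsub : {p ∈ listPairs {1, 7} 7 | Q 7 p.1 p.2} ⊆ listPairs {1, 7} 7 :=
    fun p hp => hp.1
  unfold completionGenFun
  simp only [List.sum_cons, List.sum_nil, Nat.reduceAdd]
  rw [hu] at hsub ⊢
  have hinj : ∀ a : ℕ, Function.Injective fun p : List ℕ × List ℕ => (a :: p.1, p.2) := by
    intro a p q h
    simp only [Prod.mk.injEq, List.cons.injEq, true_and] at h
    exact Prod.ext h.1 h.2
  rw [genFun_union, genFun_image (hinj 1) 1 0, genFun_image (hinj 7) 7 7]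
  · rintro ⟨T, B⟩ -
    rw [completionWeight, completionWeight, ← expo_add]
    simp [redIndex]
  · rintro ⟨T, B⟩ -
    rw [completionWeight, completionWeight, ← expo_add]
    simp [redIndex]
  · rw [Set.disjoint_left]
    rintro _ ⟨p, -, rfl⟩ ⟨q, -, h⟩
    simp at h
  · exact finite_completions zero_notMem_one_seven _ _ (Set.subset_union_left.trans hsub)
  · exact finite_completions zero_notMem_one_seven _ _ (Set.subset_union_right.trans hsub)

/-- Elimination of `B`, …, `F`: the coefficients are polynomial multipliers of the equations,
cleared of denominators by the factor `f`. -/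
theorem linear_system_solution {S : Type*} [CommRing S] (x y z A B C D E F G : S)
    (hA : A = x ^ 1 * y ^ 1 * z + x ^ 1 * y ^ 0 * F)
    (hB : B = x ^ 1 * y ^ 1 * A + x ^ 2 * y ^ 0 * E)
    (hC : C = x ^ 1 * y ^ 1 * B + x ^ 3 * y ^ 0 * D)
    (hD : D = x ^ 1 * y ^ 1 * C + x ^ 4 * y ^ 1 * C)
    (hE : E = x ^ 1 * y ^ 0 * D + x ^ 5 * y ^ 1 * B)
    (hF : F = x ^ 1 * y ^ 0 * E + x ^ 6 * y ^ 1 * A)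
    (hG : G = x ^ 1 * y ^ 0 * F + x ^ 7 * y ^ 7 * z) :
    (1 - x ^ 4 * y - x ^ 5 * y ^ 2 - x ^ 6 * y ^ 3 - 3 * x ^ 7 * y - 2 * x ^ 8 * y ^ 2
      - x ^ 9 * y ^ 3 - x ^ 18 * y ^ 3 - x ^ 21 * y ^ 3 + 2 * x ^ 11 * y ^ 2
      + 2 * x ^ 12 * y ^ 3 + 3 * x ^ 14 * y ^ 2 + 2 * x ^ 15 * y ^ 3) *
        (A + G - (x * y + x ^ 7 * y ^ 7) * z) =
      (2 * x ^ 7 * y ^ 4 + 2 * x ^ 8 * y ^ 2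
      + 2 * x ^ 9 * y ^ 3 + 2 * x ^ 10 * y ^ 4 - 2 * x ^ 12 * y ^ 3 - 4 * x ^ 13 * y ^ 4
      - 4 * x ^ 15 * y ^ 3 - 4 * x ^ 16 * y ^ 4 + 2 * x ^ 19 * y ^ 4 + 2 * x ^ 22 * y ^ 4) * z := by
  linear_combination
    (1 - x ^ 4 * y - x ^ 5 * y ^ 2 + x ^ 6 * y ^ 3 - x ^ 7 * y + x ^ 9 * y ^ 3
      - 2 * x ^ 12 * y ^ 3 - x ^ 14 * y ^ 2 - 2 * x ^ 15 * y ^ 3 + x ^ 18 * y ^ 3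
      + x ^ 21 * y ^ 3) * hA
    + (2 * x ^ 5 * y ^ 2 + 2 * x ^ 7 * y + 2 * x ^ 8 * y ^ 2 - 2 * x ^ 11 * y ^ 2
      - 2 * x ^ 14 * y ^ 2) * hB
    + (2 * x ^ 4 * y + 2 * x ^ 7 * y) * hC + 2 * x ^ 3 * hD
    + (2 * x ^ 2 - 2 * x ^ 6 * y - 2 * x ^ 9 * y) * hE
    + (2 * x - 2 * x ^ 5 * y - 2 * x ^ 6 * y ^ 2 - 4 * x ^ 8 * y - 2 * x ^ 9 * y ^ 2
      + 2 * x ^ 12 * y ^ 2 + 2 * x ^ 15 * y ^ 2) * hF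
    + (1 - x ^ 4 * y - x ^ 5 * y ^ 2 - x ^ 6 * y ^ 3 - 3 * x ^ 7 * y - 2 * x ^ 8 * y ^ 2
      - x ^ 9 * y ^ 3 - x ^ 18 * y ^ 3 - x ^ 21 * y ^ 3 + 2 * x ^ 11 * y ^ 2
      + 2 * x ^ 12 * y ^ 3 + 3 * x ^ 14 * y ^ 2 + 2 * x ^ 15 * y ^ 3) * hG

/-- The numerator `f` as a power series. -/
noncomputable def numeratorSeries : MvPowerSeries (Fin 2) ℚ :=
  let x : MvPowerSeries (Fin 2) ℚ := MvPowerSeries.X 0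
  let y : MvPowerSeries (Fin 2) ℚ := MvPowerSeries.X 1
  1 - x ^ 4 * y - x ^ 5 * y ^ 2 - x ^ 6 * y ^ 3 - 3 * x ^ 7 * y - 2 * x ^ 8 * y ^ 2
    - x ^ 9 * y ^ 3 - x ^ 18 * y ^ 3 - x ^ 21 * y ^ 3 + 2 * x ^ 11 * y ^ 2
    + 2 * x ^ 12 * y ^ 3 + 3 * x ^ 14 * y ^ 2 + 2 * x ^ 15 * y ^ 3

/-- The polynomial `f * (1 - x y - x ^ 7 y ^ 7) - g` as a power series. -/
noncomputable def remainderSeries : MvPowerSeries (Fin 2) ℚ :=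
  let x : MvPowerSeries (Fin 2) ℚ := MvPowerSeries.X 0
  let y : MvPowerSeries (Fin 2) ℚ := MvPowerSeries.X 1
  2 * x ^ 7 * y ^ 4 + 2 * x ^ 8 * y ^ 2
    + 2 * x ^ 9 * y ^ 3 + 2 * x ^ 10 * y ^ 4 - 2 * x ^ 12 * y ^ 3 - 4 * x ^ 13 * y ^ 4
    - 4 * x ^ 15 * y ^ 3 - 4 * x ^ 16 * y ^ 4 + 2 * x ^ 19 * y ^ 4 + 2 * x ^ 22 * y ^ 4

/-- The seven lists, of sums 1 to 7, are closed under reading 1 or 7; each transition is a short run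
of `redIndex`. -/
theorem numeratorSeries_mul_completionGenFun (hQ : IsReadable Q) :
    numeratorSeries * (completionGenFun Q [1] + completionGenFun Q [7] -
      (MvPowerSeries.X 0 * MvPowerSeries.X 1 + MvPowerSeries.X 0 ^ 7 * MvPowerSeries.X 1 ^ 7) *
        completionGenFun Q []) =
      remainderSeries * completionGenFun Q [] := by
  refine linear_system_solution (MvPowerSeries.X 0) (MvPowerSeries.X 1) (completionGenFun Q [])
    (completionGenFun Q [1]) (completionGenFun Q [1, 1]) (completionGenFun Q [1, 1, 1])
    (completionGenFun Q [1, 1, 1, 1]) (completionGenFun Q [3, 1, 1]) (completionGenFun Q [5, 1])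
    (completionGenFun Q [7]) ?_ ?_ ?_ ?_ ?_ ?_ (completionGenFun_seven hQ) <;>
  refine completionGenFun_eq hQ _ _ _ _ _ _ ?_ ?_ ?_ ?_ ?_ ?_ ?_ <;> simp [redIndex]

/-- A nonempty pair is read by its first upper part; exchanging the sides makes it the reduced list
`[1]` or `[7]`. The summand 1 is the empty pair. -/
theorem genFun_total (P : List ℕ → List ℕ → Prop) (h0 : P [] [])
    (hP : ∀ p T B, 0 < p → (∀ x ∈ B, 0 < x) → (P (p :: T) B ↔ Q p B T)) :
    genFun {p ∈ listPairs {1, 7} 0 | P p.1 p.2} (completionWeight []) =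
      1 + (completionGenFun Q [1] + completionGenFun Q [7]) := by
  have hpos : ∀ B : List ℕ, (∀ x ∈ B, x ∈ ({1, 7} : Set ℕ)) → ∀ x ∈ B, 0 < x := by
    intro B hB x hx
    rcases hB x hx with rfl | rfl <;> norm_num
  have hu : {p ∈ listPairs {1, 7} 0 | P p.1 p.2} =
      (fun p : List ℕ × List ℕ => p) '' {([], [])} ∪
      ((fun p : List ℕ × List ℕ => (1 :: p.2, p.1)) ''
        {p ∈ listPairs {1, 7} 1 | Q 1 p.1 p.2} ∪
      (fun p : List ℕ × List ℕ => (7 :: p.2, p.1)) ''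
        {p ∈ listPairs {1, 7} 7 | Q 7 p.1 p.2}) := by
    ext ⟨T, B⟩
    constructor
    · rintro ⟨⟨hT, hB, hsum⟩, hq⟩
      have hBpos := hpos B hB
      rcases T with _ | ⟨x, T⟩
      · left
        rcases B with _ | ⟨b, B⟩
        · exact ⟨([], []), rfl, rfl⟩
        · have := hBpos b (by simp)
          simp only [List.sum_nil, List.sum_cons] at hsum
          omega
      · right
        simp only [List.mem_cons, forall_eq_or_imp, List.sum_cons] at hT hB hsum hq
        obtain ⟨rfl | rfl, hT⟩ := hT
        · left
          rw [hP _ _ _ one_pos hBpos] at hq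
          exact ⟨(B, T), ⟨⟨hB, hT, by simp only; omega⟩, hq⟩, rfl⟩
        · right
          rw [hP _ _ _ (by norm_num) hBpos] at hq
          exact ⟨(B, T), ⟨⟨hB, hT, by simp only; omega⟩, hq⟩, rfl⟩
    · rintro (⟨_, rfl, he⟩ | ⟨⟨T', B'⟩, ⟨⟨hT, hB, hsum⟩, hq⟩, he⟩ |
        ⟨⟨T', B'⟩, ⟨⟨hT, hB, hsum⟩, hq⟩, he⟩)
      · obtain ⟨rfl, rfl⟩ := Prod.mk.inj he
        exact ⟨⟨by simp, by simp, by simp⟩, h0⟩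
      · obtain ⟨rfl, rfl⟩ := Prod.mk.inj he
        refine ⟨⟨by simpa using hB, hT, ?_⟩, (hP _ _ _ one_pos (hpos _ hT)).2 hq⟩
        simp only [List.sum_cons] at hsum ⊢
        omega
      · obtain ⟨rfl, rfl⟩ := Prod.mk.inj he
        refine ⟨⟨by simpa using hB, hT, ?_⟩, (hP _ _ _ (by norm_num) (hpos _ hT)).2 hq⟩
        simp only [List.sum_cons] at hsum ⊢
        omega
  have hsub : {p ∈ listPairs {1, 7} 0 | P p.1 p.2} ⊆ listPairs {1, 7} 0 := fun p hp => hp.1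
  have hone : genFun {(([], []) : List ℕ × List ℕ)} (fun _ => 0) = 1 := by
    classical
    ext m
    rw [coeff_genFun, MvPowerSeries.coeff_one]
    by_cases hm : m = 0
    · subst hm
      simp
    · have : {a ∈ ({([], [])} : Set (List ℕ × List ℕ)) | (0 : Fin 2 →₀ ℕ) = m} = ∅ := by
        rw [Set.eq_empty_iff_forall_notMem]
        rintro _ ⟨-, h⟩
        exact hm h.symm
      rw [this, if_neg hm]
      simp
  have hinj : ∀ a : ℕ, Function.Injective fun p : List ℕ × List ℕ => (a :: p.2, p.1) := by
    intro a p q h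
    simp only [Prod.mk.injEq, List.cons.injEq, true_and] at h
    exact Prod.ext h.2 h.1
  have hw : ∀ a : ℕ, ∀ q : List ℕ × List ℕ, q.1.sum = a + q.2.sum →
      completionWeight [] (a :: q.2, q.1) = expo 0 0 + completionWeight [a] q := by
    rintro a ⟨T, B⟩ hsum
    simp only at hsum
    rw [completionWeight, completionWeight, ← expo_add, zero_add, zero_add, List.nil_append,
      redIndex_swap (a :: B) T (by simp only [List.sum_cons]; omega)]
    congr 1
    simp only [List.sum_cons]
    omega
  rw [hu] at hsub ⊢
  have hsub' := Set.subset_union_right.trans hsub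
  rw [genFun_union, genFun_union, genFun_image (w' := fun _ => 0) (fun _ _ h => h) 0 0,
    genFun_image (w' := completionWeight [1]) (hinj 1) 0 0,
    genFun_image (w' := completionWeight [7]) (hinj 7) 0 0, hone]
  · simp [completionGenFun]
  · rintro q ⟨⟨-, -, hsum⟩, -⟩
    exact hw 7 q hsum
  · rintro q ⟨⟨-, -, hsum⟩, -⟩
    exact hw 1 q hsum
  · rintro _ rfl
    rw [completionWeight, add_zero]
    simp [redIndex]
  · rw [Set.disjoint_left]
    rintro _ ⟨p, -, rfl⟩ ⟨q, -, h⟩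
    simp at h
  · exact finite_completions zero_notMem_one_seven _ _ (Set.subset_union_left.trans hsub')
  · exact finite_completions zero_notMem_one_seven _ _ (Set.subset_union_right.trans hsub')
  · rw [Set.disjoint_left]
    rintro _ ⟨p, rfl, rfl⟩ (⟨q, -, h⟩ | ⟨q, -, h⟩) <;> simp at h
  · exact finite_completions zero_notMem_one_seven _ _ (Set.subset_union_left.trans hsub)
  · exact finite_completions zero_notMem_one_seven _ _ (Set.subset_union_right.trans hsub)

end Counting

/-! ### Meanders as pairs of lists, and indecomposability as first return. -/

section Meanders

theorem ncard_meanders (n : ℕ) (P : List ℕ → List ℕ → Prop) :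
    {M : Meander n | P M.top.blocks M.bot.blocks}.ncard =
      {p : List ℕ × List ℕ | (∀ x ∈ p.1, 0 < x) ∧ (∀ x ∈ p.2, 0 < x) ∧ p.1.sum = n ∧
        p.2.sum = n ∧ P p.1 p.2}.ncard := by
  have hinj : Function.Injective fun M : Meander n => (M.top.blocks, M.bot.blocks) := by
    rintro ⟨t, b⟩ ⟨t', b'⟩ h
    obtain ⟨h1, h2⟩ := Prod.mk.inj h
    exact congrArg₂ Meander.mk (Composition.ext h1) (Composition.ext h2)
  rw [← Set.ncard_image_of_injective _ hinj]
  congr 1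
  ext ⟨T, B⟩
  constructor
  · rintro ⟨M, hM, he⟩
    obtain ⟨rfl, rfl⟩ := Prod.mk.inj he
    exact ⟨fun x hx => M.top.blocks_pos hx, fun x hx => M.bot.blocks_pos hx, M.top.blocks_sum,
      M.bot.blocks_sum, hM⟩
  · rintro ⟨h1, h2, h3, h4, h5⟩
    exact ⟨⟨⟨T, fun {i} hi => h1 i hi, h3⟩, ⟨B, fun {i} hi => h2 i hi, h4⟩⟩, h5, rfl⟩

theorem ncard_meanders_eq_coeff {J : Set ℕ} (hJ : 0 ∉ J) (P : List ℕ → List ℕ → Prop)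
    (n k : ℕ) :
    (({M : Meander n | ((∀ x ∈ M.top.blocks, x ∈ J) ∧ ∀ x ∈ M.bot.blocks, x ∈ J) ∧
        P M.top.blocks M.bot.blocks ∧ redIndex M.top.blocks M.bot.blocks = k}.ncard : ℕ) : ℚ) =
      MvPowerSeries.coeff (expo n k)
        (genFun {p ∈ listPairs J 0 | P p.1 p.2} (completionWeight [])) := by
  rw [coeff_genFun, ncard_meanders n fun T B => ((∀ x ∈ T, x ∈ J) ∧ ∀ x ∈ B, x ∈ J) ∧
    P T B ∧ redIndex T B = k]
  congr 2
  have hpos : ∀ x ∈ J, 0 < x := fun x hx => Nat.pos_of_ne_zero fun h => hJ (h ▸ hx)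
  ext ⟨T, B⟩
  simp only [listPairs, completionWeight, Set.mem_ofPred_eq, List.nil_append, eq_expo_iff,
    expo_zero_apply, expo_one_apply, zero_add]
  constructor
  · rintro ⟨-, -, h1, h2, ⟨h3, h4⟩, h5, h6⟩
    exact ⟨⟨⟨h3, h4, by omega⟩, h5⟩, h1, h6⟩
  · rintro ⟨⟨⟨h3, h4, h1⟩, h5⟩, h2, h6⟩
    exact ⟨fun x hx => hpos x (h3 x hx), fun x hx => hpos x (h4 x hx), h2, by omega, ⟨h3, h4⟩,
      h5, h6⟩

theorem meanderGenFun_eq_genFun (K : Type*) [Field K] [CharZero K] {J : Set ℕ} (hJ : 0 ∉ J) :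
    meanderGenFun K J = genFun (listPairs J 0) (completionWeight []) := by
  ext m
  have h1 := ncard_meanders_eq_coeff hJ (fun _ _ => True) (m 0) (m 1)
  rw [(eq_expo_iff m _ _).2 ⟨rfl, rfl⟩] at h1
  simp only [true_and, and_true] at h1
  change (meanderCount K J (m 0) (m 1) : ℚ) = _
  refine Eq.trans ?_ (h1.trans ?_)
  · simp only [meanderCount, Meander.PartsIn, Meander.ind_eq_redIndex]
  · congr 2

/-- The lists of upper and lower parts do not split into two nonempty pairs with equal sums. -/
def IsIndecomposablePair (T B : List ℕ) : Prop :=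
  ∀ T₁ T₂ B₁ B₂, T = T₁ ++ T₂ → B = B₁ ++ B₂ → T₁.sum = B₁.sum →
    (T₁ = [] ∧ B₁ = []) ∨ (T₂ = [] ∧ B₂ = [])

/-- The upper and lower sums agree only at the very end, when the lower side starts `s` ahead. -/
def IsFirstReturn (s : ℕ) (T B : List ℕ) : Prop :=
  -- A lead of 0 means that the return has already happened, so nothing may follow.
  if s = 0 then T = [] ∧ B = [] else
    ∀ T₁ T₂ B₁ B₂, T = T₁ ++ T₂ → B = B₁ ++ B₂ → T₁.sum = s + B₁.sum → T₂ = [] ∧ B₂ = []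

theorem isReadable_isFirstReturn : IsReadable IsFirstReturn where
  of_le := by
    intro s p T B hp hps
    have hs : s ≠ 0 := by omega
    rw [IsFirstReturn, IsFirstReturn, if_neg hs]
    split_ifs with h0
    · have hsp : s = p := by omega
      subst hsp
      constructor
      · intro h
        exact h [s] T [] B rfl rfl (by simp)
      · rintro ⟨rfl, rfl⟩ T₁ T₂ B₁ B₂ h1 h2 h3
        obtain ⟨rfl, rfl⟩ := List.append_eq_nil_iff.1 h2.symm
        rcases T₁ with _ | ⟨t, T₁⟩
        · simp only [List.sum_nil] at h3
          omega
        · simp only [List.cons_append, List.cons.injEq] at h1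
          exact ⟨(List.append_eq_nil_iff.1 h1.2.symm).2, rfl⟩
    · constructor
      · intro h T₁ T₂ B₁ B₂ h1 h2 h3
        refine h (p :: T₁) T₂ B₁ B₂ (by rw [h1, List.cons_append]) h2 ?_
        simp only [List.sum_cons]
        omega
      · intro h T₁ T₂ B₁ B₂ h1 h2 h3
        rcases T₁ with _ | ⟨t, T₁⟩
        · simp only [List.sum_nil] at h3
          omega
        · simp only [List.cons_append, List.cons.injEq] at h1
          obtain ⟨rfl, h1⟩ := h1
          simp only [List.sum_cons] at h3
          exact h T₁ T₂ B₁ B₂ h1 h2 (by omega)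
  of_lt := by
    intro s p T B hs hsp
    rw [IsFirstReturn, IsFirstReturn, if_neg (by omega), if_neg (by omega)]
    constructor
    · intro h B₁ B₂ T₁ T₂ h2 h1 h3
      refine (h (p :: T₁) T₂ B₁ B₂ (by rw [h1, List.cons_append]) h2 ?_).symm
      simp only [List.sum_cons]
      omega
    · intro h T₁ T₂ B₁ B₂ h1 h2 h3
      rcases T₁ with _ | ⟨t, T₁⟩
      · simp only [List.sum_nil] at h3
        omega
      · simp only [List.cons_append, List.cons.injEq] at h1
        obtain ⟨rfl, h1⟩ := h1
        simp only [List.sum_cons] at h3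
        exact (h B₁ B₂ T₁ T₂ h2 h1 (by omega)).symm

theorem eq_nil_of_sum_eq_zero {l : List ℕ} (hl : ∀ x ∈ l, 0 < x) (h : l.sum = 0) : l = [] := by
  rcases l with _ | ⟨a, l⟩
  · rfl
  · have := hl a (by simp)
    simp only [List.sum_cons] at h
    omega

/-- Once an upper part `p` is read, an indecomposable pair is one whose partial sums meet again only
at the end. Positivity of the parts of `B` excludes a split with empty upper and nonempty lower
half. -/
theorem isIndecomposablePair_cons_iff (p : ℕ) (T B : List ℕ) (hp : 0 < p)
    (hB : ∀ x ∈ B, 0 < x) : IsIndecomposablePair (p :: T) B ↔ IsFirstReturn p B T := by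
  rw [IsIndecomposablePair, IsFirstReturn, if_neg (by omega)]
  constructor
  · intro h B₁ B₂ T₁ T₂ h2 h1 h3
    rcases h (p :: T₁) T₂ B₁ B₂ (by rw [h1, List.cons_append]) h2
      (by simp only [List.sum_cons]; omega) with h4 | h4
    · simp at h4
    · exact h4.symm
  · intro h T₁ T₂ B₁ B₂ h1 h2 h3
    rcases T₁ with _ | ⟨t, T₁⟩
    · left
      refine ⟨rfl, eq_nil_of_sum_eq_zero (fun x hx => hB x ?_) h3.symm⟩
      rw [h2]
      exact List.mem_append_left _ hx
    · simp only [List.cons_append, List.cons.injEq] at h1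
      obtain ⟨rfl, h1⟩ := h1
      simp only [List.sum_cons] at h3
      exact Or.inr (h B₁ B₂ T₁ T₂ h2 h1 (by omega)).symm

/-- As all parts are positive, a summand has strictly fewer nodes exactly when the complementary
pair of lists is nonempty. -/
theorem Meander.not_decomposable_iff {n : ℕ} (M : Meander n) :
    ¬ M.Decomposable ↔ IsIndecomposablePair M.top.blocks M.bot.blocks := by
  have hT : ∀ x ∈ M.top.blocks, 0 < x := fun x hx => M.top.blocks_pos hx
  have hB : ∀ x ∈ M.bot.blocks, 0 < x := fun x hx => M.bot.blocks_pos hx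
  have hTs := M.top.blocks_sum
  have hBs := M.bot.blocks_sum
  rw [not_iff_comm]
  constructor
  · intro h
    unfold IsIndecomposablePair at h
    push Not at h
    obtain ⟨T₁, T₂, B₁, B₂, h1, h2, h3, h4, h5⟩ := h
    rw [h1] at hT hTs
    rw [h2] at hB hBs
    simp only [List.mem_append, List.sum_append] at hT hB hTs hBs
    have e1 : T₁.sum ≠ 0 := fun h0 => h4 (eq_nil_of_sum_eq_zero (fun x hx => hT x (Or.inl hx)) h0)
      (eq_nil_of_sum_eq_zero (fun x hx => hB x (Or.inl hx)) (h3 ▸ h0))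
    have e2 : T₂.sum ≠ 0 := fun h0 => h5 (eq_nil_of_sum_eq_zero (fun x hx => hT x (Or.inr hx)) h0)
      (eq_nil_of_sum_eq_zero (fun x hx => hB x (Or.inr hx)) (by omega))
    refine ⟨T₁.sum, T₂.sum, ⟨⟨T₁, fun {i} hi => hT i (Or.inl hi), rfl⟩,
      ⟨B₁, fun {i} hi => hB i (Or.inl hi), h3.symm⟩⟩, ⟨⟨T₂, fun {i} hi => hT i (Or.inr hi), rfl⟩,
      ⟨B₂, fun {i} hi => hB i (Or.inr hi), by omega⟩⟩, by omega, by omega, h1, h2⟩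
  · rintro ⟨a, b, P, Q, ha, hb, h1, h2⟩ h
    change _ = P.top.blocks ++ Q.top.blocks at h1
    change _ = P.bot.blocks ++ Q.bot.blocks at h2
    have e1 := P.top.blocks_sum
    have e2 := Q.top.blocks_sum
    have hab : a + b = n := by
      rw [← hTs, h1, List.sum_append, e1, e2]
    rcases h _ _ _ _ h1 h2 (by rw [e1, P.bot.blocks_sum]) with ⟨h3, -⟩ | ⟨h3, -⟩
    · rw [h3, List.sum_nil] at e1
      omega
    · rw [h3, List.sum_nil] at e2
      omega

theorem indecomposableCount_eq_coeff (K : Type*) [Field K] [CharZero K] {J : Set ℕ}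
    (hJ : 0 ∉ J) (n k : ℕ) :
    (indecomposableCount K J n k : ℚ) = MvPowerSeries.coeff (expo n k)
      (genFun {p ∈ listPairs J 0 | IsIndecomposablePair p.1 p.2} (completionWeight [])) := by
  rw [← ncard_meanders_eq_coeff hJ]
  simp only [indecomposableCount, Meander.PartsIn, Meander.ind_eq_redIndex,
    Meander.not_decomposable_iff, Nat.cast_inj]

theorem indecomposableCount_of_neg (K : Type*) [Field K] (J : Set ℕ) (n : ℕ) {k : ℤ}
    (hk : k < 0) : indecomposableCount K J n k = 0 := by
  have h : {M : Meander n | M.PartsIn J ∧ ¬ M.Decomposable ∧ (M.ind K : ℤ) = k} = ∅ := by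
    rw [Set.eq_empty_iff_forall_notMem]
    rintro M ⟨-, -, hM⟩
    omega
  rw [indecomposableCount, h, Set.ncard_empty]

end Meanders

/-! ### Scaling all parts by `c`. -/

section Scaling

/-- Every comparison and every new part in the recursion is homogeneous in the parts. -/
theorem redIndex_map_mul (c : ℕ) (hc : 0 < c) (T B : List ℕ) :
    redIndex (T.map (c * ·)) (B.map (c * ·)) = c * redIndex T B := by
  have hlt : ∀ a b : ℕ, c * a < c * b ↔ a < b := fun a b => Nat.mul_lt_mul_left hc
  have hle : ∀ a b : ℕ, c * a ≤ c * b ↔ a ≤ b := fun a b => Nat.mul_le_mul_left_iff hc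
  have hne : ∀ {a : ℕ}, a ≠ 0 → c * a ≠ 0 := fun ha => Nat.mul_ne_zero hc.ne' ha
  have hinj : ∀ {a b : ℕ}, c * a = c * b → a = b := fun h => Nat.eq_of_mul_eq_mul_left hc h
  have hcomm : ∀ a : ℕ, 2 * (c * a) = c * (2 * a) := fun a => Nat.mul_left_comm _ _ _
  induction T, B using redIndex.induct with
  | case1 B => simp [redIndex]
  | case2 a T => simp [redIndex]
  | case3 T b B ih =>
    rw [redIndex, if_pos rfl, ← ih]
    simp [redIndex]
  | case4 a T B ha ih =>
    rw [redIndex, if_neg ha, if_pos rfl, ← ih]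
    simp [redIndex, hc.ne', ha]
  | case5 T b B hb _ ih =>
    rw [redIndex, if_neg hb, if_neg hb, if_pos rfl, mul_add, ← ih]
    simp [redIndex, hc.ne', hb]
  | case6 a T b B ha hb hab hlt' h2a ih =>
    rw [redIndex, if_neg ha, if_neg hb, if_neg hab, if_pos hlt', if_pos h2a, ← ih]
    simp only [List.map_cons]
    rw [redIndex, if_neg (hne ha), if_neg (hne hb), if_neg fun h => hab (hinj h),
      if_pos ((hlt _ _).2 hlt'), if_pos (by rwa [hcomm, hle]), hcomm, Nat.mul_sub]
  | case7 a T b B ha hb hab hlt' h2a ih =>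
    rw [redIndex, if_neg ha, if_neg hb, if_neg hab, if_pos hlt', if_neg h2a, ← ih]
    simp only [List.map_cons]
    rw [redIndex, if_neg (hne ha), if_neg (hne hb), if_neg fun h => hab (hinj h),
      if_pos ((hlt _ _).2 hlt'), if_neg (by rwa [hcomm, hle]), hcomm, Nat.mul_sub]
  | case8 a T b B ha hb hab hlt' h2b ih =>
    rw [redIndex, if_neg ha, if_neg hb, if_neg hab, if_neg hlt', if_pos h2b, ← ih]
    simp only [List.map_cons]
    rw [redIndex, if_neg (hne ha), if_neg (hne hb), if_neg fun h => hab (hinj h),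
      if_neg (mt (hlt _ _).1 hlt'), if_pos (by rwa [hcomm, hle]), hcomm, Nat.mul_sub]
  | case9 a T b B ha hb hab hlt' h2b ih =>
    rw [redIndex, if_neg ha, if_neg hb, if_neg hab, if_neg hlt', if_neg h2b, ← ih]
    simp only [List.map_cons]
    rw [redIndex, if_neg (hne ha), if_neg (hne hb), if_neg fun h => hab (hinj h),
      if_neg (mt (hlt _ _).1 hlt'), if_neg (by rwa [hcomm, hle]), hcomm, Nat.mul_sub]

theorem exists_map_mul_of_mem {c : ℕ} {J : Set ℕ} (l : List ℕ)
    (h : ∀ x ∈ l, x ∈ (c * ·) '' J) : ∃ l' : List ℕ, (∀ x ∈ l', x ∈ J) ∧ l'.map (c * ·) = l := by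
  induction l with
  | nil => exact ⟨[], by simp, rfl⟩
  | cons a l ih =>
    obtain ⟨l', h1, h2⟩ := ih fun x hx => h x (List.mem_cons_of_mem _ hx)
    obtain ⟨a', ha, rfl⟩ := h a (by simp)
    exact ⟨a' :: l', by simpa using ⟨ha, h1⟩, by simp [h2]⟩

/-- Scaling is a bijection of pairs that multiplies both exponents by `c`; no other exponents occur.
-/
theorem genFun_listPairs_image_mul {c : ℕ} (hc : c ≠ 0) (J : Set ℕ) :
    genFun (listPairs ((c * ·) '' J) 0) (completionWeight []) =
      MvPowerSeries.expand c hc (genFun (listPairs J 0) (completionWeight [])) := by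
  have hc0 : 0 < c := Nat.pos_of_ne_zero hc
  have hsum : ∀ l : List ℕ, (l.map (c * ·)).sum = c * l.sum := fun l => by
    simpa using List.sum_map_mul_left l id c
  let φ : List ℕ × List ℕ → List ℕ × List ℕ := fun p => (p.1.map (c * ·), p.2.map (c * ·))
  have hlist : Function.Injective (List.map (c * ·)) :=
    List.map_injective_iff.2 fun a b h => Nat.eq_of_mul_eq_mul_left hc0 h
  have hφ : Function.Injective φ := by
    intro p q h
    exact Prod.ext (hlist (Prod.mk.inj h).1) (hlist (Prod.mk.inj h).2)
  have hS : listPairs ((c * ·) '' J) 0 = φ '' listPairs J 0 := by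
    ext ⟨T, B⟩
    constructor
    · rintro ⟨h1, h2, h3⟩
      obtain ⟨T', hT, rfl⟩ := exists_map_mul_of_mem T h1
      obtain ⟨B', hB, rfl⟩ := exists_map_mul_of_mem B h2
      refine ⟨(T', B'), ⟨hT, hB, ?_⟩, rfl⟩
      simp only [zero_add, hsum] at h3 ⊢
      exact Nat.eq_of_mul_eq_mul_left hc0 h3
    · rintro ⟨⟨T', B'⟩, ⟨h1, h2, h3⟩, he⟩
      obtain ⟨rfl, rfl⟩ := Prod.mk.inj he
      refine ⟨?_, ?_, ?_⟩
      · simpa [hc] using h1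
      · simpa [hc] using h2
      · simp only [zero_add, hsum] at h3 ⊢
        rw [h3]
  have hw : ∀ p, completionWeight [] (φ p) = c • completionWeight [] p := by
    intro p
    rw [completionWeight, eq_expo_iff]
    simp [completionWeight, φ, hsum, redIndex_map_mul c hc0]
  ext m
  by_cases hm : c ∣ m 0 ∧ c ∣ m 1
  · obtain ⟨⟨n, hn⟩, ⟨k, hk⟩⟩ := hm
    have hm : m = c • expo n k := by
      ext i
      fin_cases i <;> simp [hn, hk]
    rw [hm, MvPowerSeries.coeff_expand_smul, coeff_genFun, coeff_genFun, hS,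
      ← Set.ncard_image_of_injective {p ∈ listPairs J 0 | completionWeight [] p = expo n k} hφ]
    congr 2
    ext q
    constructor
    · rintro ⟨⟨p, hp, rfl⟩, h⟩
      rw [hw] at h
      exact ⟨p, ⟨hp, smul_right_injective _ hc h⟩, rfl⟩
    · rintro ⟨p, ⟨hp, h⟩, rfl⟩
      exact ⟨⟨p, hp, rfl⟩, by rw [hw, h]⟩
  · have h0 : MvPowerSeries.coeff m (MvPowerSeries.expand c hc
        (genFun (listPairs J 0) (completionWeight []))) = 0 := by
      rw [not_and_or] at hm
      rcases hm with hm | hm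
      · exact MvPowerSeries.coeff_expand_of_not_dvd _ _ _ hm
      · exact MvPowerSeries.coeff_expand_of_not_dvd _ _ _ hm
    have : {a ∈ listPairs ((c * ·) '' J) 0 | completionWeight [] a = m} = ∅ := by
      rw [Set.eq_empty_iff_forall_notMem]
      rintro q ⟨hq, h⟩
      rw [hS] at hq
      obtain ⟨p, -, rfl⟩ := hq
      rw [hw] at h
      refine hm ⟨?_, ?_⟩ <;> simp [← h]
    rw [h0, coeff_genFun, this]
    simp

end Scaling

/-! ### The rational generating function, the recurrence, and the main theorem. -/

section Final

theorem coe_numeratorPoly : (numeratorPoly : MvPowerSeries (Fin 2) ℚ) = numeratorSeries := by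
  rw [← MvPolynomial.coeToMvPowerSeries.ringHom_apply, numeratorPoly, numeratorSeries]
  simp only [map_sub, map_add, map_mul, map_pow, map_one, map_ofNat,
    MvPolynomial.coeToMvPowerSeries.ringHom_apply, MvPolynomial.coe_X]

theorem coe_denominatorPoly : (denominatorPoly : MvPowerSeries (Fin 2) ℚ) =
    numeratorSeries * (1 - MvPowerSeries.X 0 * MvPowerSeries.X 1 -
      MvPowerSeries.X 0 ^ 7 * MvPowerSeries.X 1 ^ 7) - remainderSeries := by
  rw [← coe_numeratorPoly, ← MvPolynomial.coeToMvPowerSeries.ringHom_apply, denominatorPoly,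
    remainderSeries]
  simp only [map_sub, map_add, map_mul, map_pow, map_one, map_ofNat,
    MvPolynomial.coeToMvPowerSeries.ringHom_apply, MvPolynomial.coe_X]
  ring

theorem constantCoeff_denominatorPoly :
    MvPowerSeries.constantCoeff (denominatorPoly : MvPowerSeries (Fin 2) ℚ) = 1 := by
  rw [coe_denominatorPoly]
  simp [numeratorSeries, remainderSeries]

/-- With no restriction on completions, what follows a return is an arbitrary meander, so `z = A`
and `A = 1 + (completions of [1] and [7])`. -/
theorem denominatorPoly_mul_meanderGenFun (K : Type*) [Field K] [CharZero K] :
    (denominatorPoly : MvPowerSeries (Fin 2) ℚ) * meanderGenFun K {1, 7} = numeratorPoly := by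
  have hQ : IsReadable fun _ _ _ => True := ⟨by simp, by simp⟩
  have h1 := genFun_total (Q := fun _ _ _ => True) (fun _ _ => True) trivial (by simp)
  have h2 := numeratorSeries_mul_completionGenFun hQ
  have h3 : completionGenFun (fun _ _ _ => True) [] = meanderGenFun K {1, 7} := by
    rw [meanderGenFun_eq_genFun K zero_notMem_one_seven]
    refine genFun_congr ?_ fun _ _ => rfl
    ext p
    simp
  have h4 : genFun {p ∈ listPairs {1, 7} 0 | True} (completionWeight []) =
      meanderGenFun K {1, 7} := by
    rw [meanderGenFun_eq_genFun K zero_notMem_one_seven]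
    refine genFun_congr ?_ fun _ _ => rfl
    ext p
    simp
  rw [h3] at h2
  rw [h4] at h1
  rw [coe_denominatorPoly, coe_numeratorPoly]
  linear_combination numeratorSeries * h1 + h2

theorem coeff_X_pow_mul_X_pow_mul (φ : MvPowerSeries (Fin 2) ℚ) (n k a b : ℕ) :
    MvPowerSeries.coeff (expo n k) (MvPowerSeries.X 0 ^ a * MvPowerSeries.X 1 ^ b * φ) =
      if a ≤ n ∧ b ≤ k then MvPowerSeries.coeff (expo (n - a) (k - b)) φ else 0 := by
  classical
  rw [X_pow_mul_X_pow_eq_monomial, MvPowerSeries.coeff_monomial_mul, one_mul]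
  have h1 : expo a b ≤ expo n k ↔ a ≤ n ∧ b ≤ k := by
    rw [Finsupp.le_def, Fin.forall_fin_two]
    simp
  have h2 : expo n k - expo a b = expo (n - a) (k - b) := by
    rw [eq_comm, eq_expo_iff]
    simp
  rw [h2]
  simp only [h1]

theorem coeff_X_pow_mul_X_pow (n k a b : ℕ) (h : a < n) :
    MvPowerSeries.coeff (expo n k)
      ((MvPowerSeries.X 0 : MvPowerSeries (Fin 2) ℚ) ^ a * MvPowerSeries.X 1 ^ b) = 0 := by
  classical
  rw [X_pow_mul_X_pow_eq_monomial, MvPowerSeries.coeff_monomial, if_neg]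
  rw [eq_expo_iff, expo_zero_apply]
  omega

theorem genFun_completion_nil_isFirstReturn : completionGenFun IsFirstReturn [] = 1 := by
  classical
  ext m
  rw [completionGenFun, coeff_genFun, MvPowerSeries.coeff_one]
  have h : ∀ p : List ℕ × List ℕ, p ∈ {p ∈ listPairs {1, 7} ([] : List ℕ).sum |
      IsFirstReturn ([] : List ℕ).sum p.1 p.2} ↔ p = ([], []) := by
    rintro ⟨T, B⟩
    simp only [IsFirstReturn, listPairs, List.sum_nil, if_pos, Set.mem_ofPred_eq, Prod.mk.injEq]
    constructor
    · exact fun h => h.2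
    · rintro ⟨rfl, rfl⟩
      simp
  have hw : completionWeight [] ([], []) = 0 := by
    rw [completionWeight, eq_expo_iff]
    simp [redIndex]
  split_ifs with hm
  · have : {a ∈ {p ∈ listPairs {1, 7} ([] : List ℕ).sum |
        IsFirstReturn ([] : List ℕ).sum p.1 p.2} | completionWeight [] a = m} = {([], [])} := by
      ext p
      rw [Set.mem_ofPred_eq, h, Set.mem_singleton_iff, hm]
      exact ⟨fun h' => h'.1, fun h' => ⟨h', h' ▸ hw⟩⟩
    rw [this, Set.ncard_singleton, Nat.cast_one]
  · have : {a ∈ {p ∈ listPairs {1, 7} ([] : List ℕ).sum |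
        IsFirstReturn ([] : List ℕ).sum p.1 p.2} | completionWeight [] a = m} = ∅ := by
      rw [Set.eq_empty_iff_forall_notMem]
      rintro p ⟨hp, hpm⟩
      rw [h] at hp
      rw [hp, hw] at hpm
      exact hm hpm.symm
    rw [this, Set.ncard_empty, Nat.cast_zero]

/-- Here `z = 1`. The series `ψ` omits the empty meander and the meanders 1 over 1 and 7 over 7,
which have at most 7 nodes. -/
theorem exists_indecomposable_series (K : Type*) [Field K] [CharZero K] :
    ∃ ψ : MvPowerSeries (Fin 2) ℚ, numeratorSeries * ψ = remainderSeries ∧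
      ∀ n k : ℕ, 7 < n →
        MvPowerSeries.coeff (expo n k) ψ = (indecomposableCount K {1, 7} n k : ℚ) := by
  classical
  refine ⟨completionGenFun IsFirstReturn [1] + completionGenFun IsFirstReturn [7] -
      (MvPowerSeries.X 0 ^ 1 * MvPowerSeries.X 1 ^ 1 +
        MvPowerSeries.X 0 ^ 7 * MvPowerSeries.X 1 ^ 7), ?_, ?_⟩
  · have := numeratorSeries_mul_completionGenFun isReadable_isFirstReturn
    rw [genFun_completion_nil_isFirstReturn] at this
    linear_combination this
  · intro n k hn
    have h1 := genFun_total IsIndecomposablePair (by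
      intro T₁ T₂ B₁ B₂ h1 h2 _
      exact Or.inl ⟨(List.append_eq_nil_iff.1 h1.symm).1, (List.append_eq_nil_iff.1 h2.symm).1⟩)
      isIndecomposablePair_cons_iff
    have h2 := indecomposableCount_eq_coeff K zero_notMem_one_seven n k
    rw [h2, h1, map_sub, map_add (MvPowerSeries.coeff (expo n k)) (1 : MvPowerSeries (Fin 2) ℚ),
      map_add _ (_ ^ 1 * _), coeff_X_pow_mul_X_pow _ _ _ _ (by omega),
      coeff_X_pow_mul_X_pow _ _ _ _ (by omega), MvPowerSeries.coeff_one, if_neg]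
    · ring
    · rw [eq_expo_iff]
      simp
      omega

theorem indecomposableCount_recurrence (K : Type*) [Field K] [CharZero K] (n : ℕ) (k : ℤ)
    (hn : 28 < n) (i : ℕ → ℤ → ℤ) (hi : ∀ n k, i n k = indecomposableCount K {1, 7} n k) :
    i n k = i (n - 4) (k - 1) + i (n - 6) (k - 3) + 3 * i (n - 7) (k - 1)
      + i (n - 5) (k - 2) + 2 * i (n - 8) (k - 2) + i (n - 9) (k - 3)
      + i (n - 18) (k - 3) + i (n - 21) (k - 3)
      - 2 * i (n - 11) (k - 2) - 2 * i (n - 12) (k - 3)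
      - 3 * i (n - 14) (k - 2) - 2 * i (n - 15) (k - 3) := by
  have hneg : ∀ n k, k < 0 → i n k = 0 := fun n k hk => by
    rw [hi, indecomposableCount_of_neg K _ _ hk, Nat.cast_zero]
  rcases lt_or_ge k 0 with hk | hk
  · simp only [hneg _ k hk, hneg _ (k - 1) (by omega), hneg _ (k - 2) (by omega),
      hneg _ (k - 3) (by omega)]
    norm_num
  · obtain ⟨k, rfl⟩ := Int.eq_ofNat_of_zero_le hk
    obtain ⟨ψ, hψ, hc⟩ := exists_indecomposable_series K
    -- The largest shift is 21, so `n > 28` keeps `n - a > 7`, where `ψ` counts indecomposables. It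
    -- also exceeds 22, the `x`-degree of `remainderSeries`. For `b > k` both sides vanish.
    have hterm : ∀ a b : ℕ, a ≤ 21 →
        MvPowerSeries.coeff (expo n k) (MvPowerSeries.X 0 ^ a * MvPowerSeries.X 1 ^ b * ψ) =
          ((i (n - a) (k - b) : ℤ) : ℚ) := by
      intro a b ha
      rw [coeff_X_pow_mul_X_pow_mul]
      split_ifs with h
      · rw [hc _ _ (by omega), hi, Nat.cast_sub h.2, Int.cast_natCast]
      · rw [hneg _ _ (by omega), Int.cast_zero]
    have hzero : ∀ a b : ℕ, a ≤ 22 → MvPowerSeries.coeff (expo n k)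
        ((MvPowerSeries.X 0 : MvPowerSeries (Fin 2) ℚ) ^ a * MvPowerSeries.X 1 ^ b) = 0 :=
      fun a b ha => coeff_X_pow_mul_X_pow _ _ _ _ (by omega)
    let t : ℕ → ℕ → MvPowerSeries (Fin 2) ℚ := fun a b =>
      MvPowerSeries.X 0 ^ a * MvPowerSeries.X 1 ^ b * ψ
    let u : ℕ → ℕ → MvPowerSeries (Fin 2) ℚ := fun a b =>
      MvPowerSeries.X 0 ^ a * MvPowerSeries.X 1 ^ b
    have hL : numeratorSeries * ψ = t 0 0 - t 4 1 - t 5 2 - t 6 3 - 3 • t 7 1 - 2 • t 8 2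
        - t 9 3 - t 18 3 - t 21 3 + 2 • t 11 2 + 2 • t 12 3 + 3 • t 14 2 + 2 • t 15 3 := by
      simp only [numeratorSeries, t]
      ring
    have hR : remainderSeries = 2 • u 7 4 + 2 • u 8 2 + 2 • u 9 3 + 2 • u 10 4 - 2 • u 12 3
        - 4 • u 13 4 - 4 • u 15 3 - 4 • u 16 4 + 2 • u 19 4 + 2 • u 22 4 := by
      simp only [remainderSeries, u]
      ring
    have hcoeff := congrArg (MvPowerSeries.coeff (expo n k)) hψ
    rw [hL, hR] at hcoeff
    simp only [map_add, map_sub, map_nsmul, t, u] at hcoeff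
    rw [hterm 0 0 (by norm_num), hterm 4 1 (by norm_num), hterm 5 2 (by norm_num),
      hterm 6 3 (by norm_num), hterm 7 1 (by norm_num), hterm 8 2 (by norm_num),
      hterm 9 3 (by norm_num), hterm 18 3 (by norm_num), hterm 21 3 (by norm_num),
      hterm 11 2 (by norm_num), hterm 12 3 (by norm_num), hterm 14 2 (by norm_num),
      hterm 15 3 (by norm_num), hzero 7 4 (by norm_num), hzero 8 2 (by norm_num),
      hzero 9 3 (by norm_num), hzero 10 4 (by norm_num), hzero 12 3 (by norm_num),
      hzero 13 4 (by norm_num), hzero 15 3 (by norm_num), hzero 16 4 (by norm_num),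
      hzero 19 4 (by norm_num), hzero 22 4 (by norm_num)] at hcoeff
    simp only [nsmul_eq_mul, Nat.cast_ofNat, mul_zero, Nat.sub_zero, Nat.cast_zero,
      sub_zero, add_zero, Nat.cast_one] at hcoeff
    change i n (k : ℤ) = _
    rify
    have h2 := congrArg (fun q : ℚ => (q : ℝ)) hcoeff
    push_cast at h2
    linarith

theorem mainTheorem7 (K : Type*) [Field K] [CharZero K] :
    -- the denominator is invertible as a power series, and `A_{1,7} = f / g`
    (IsUnit (denominatorPoly : MvPowerSeries (Fin 2) ℚ) ∧
      meanderGenFun K {1, 7} =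
        (numeratorPoly : MvPowerSeries (Fin 2) ℚ) *
          (denominatorPoly : MvPowerSeries (Fin 2) ℚ)⁻¹) ∧
    -- the recurrence for the numbers of indecomposable meanders
    (let i : ℕ → ℤ → ℤ := fun n k => (indecomposableCount K {1, 7} n k : ℤ)
      ∀ (n : ℕ) (k : ℤ), 28 < n →
        i n k = i (n - 4) (k - 1) + i (n - 6) (k - 3) + 3 * i (n - 7) (k - 1)
          + i (n - 5) (k - 2) + 2 * i (n - 8) (k - 2) + i (n - 9) (k - 3)
          + i (n - 18) (k - 3) + i (n - 21) (k - 3)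
          - 2 * i (n - 11) (k - 2) - 2 * i (n - 12) (k - 3)
          - 3 * i (n - 14) (k - 2) - 2 * i (n - 15) (k - 3)) ∧
    -- `A_{c,7c}(x, y) = A_{1,7}(x ^ c, y ^ c)`
    (∀ c : ℕ, 1 ≤ c →
      meanderGenFun K {c, 7 * c} =
        MvPowerSeries.subst (fun s : Fin 2 => (MvPowerSeries.X s : MvPowerSeries (Fin 2) ℚ) ^ c)
          (meanderGenFun K {1, 7})) := by
  refine ⟨⟨?_, ?_⟩, ?_, ?_⟩
  · rw [MvPowerSeries.isUnit_iff_constantCoeff, constantCoeff_denominatorPoly]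
    exact isUnit_one
  · rw [MvPowerSeries.eq_mul_inv_iff_mul_eq (by rw [constantCoeff_denominatorPoly]; norm_num),
      mul_comm]
    exact denominatorPoly_mul_meanderGenFun K
  · intro i n k hn
    exact indecomposableCount_recurrence K n k hn i fun _ _ => rfl
  · intro c hc
    have hc0 : c ≠ 0 := by omega
    have hJ : ({c, 7 * c} : Set ℕ) = (c * ·) '' {1, 7} := by
      rw [Set.image_pair, mul_one, mul_comm]
    have h0 : (0 : ℕ) ∉ ({c, 7 * c} : Set ℕ) := by
      simp only [Set.mem_insert_iff, Set.mem_singleton_iff]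
      omega
    rw [meanderGenFun_eq_genFun K h0, meanderGenFun_eq_genFun K zero_notMem_one_seven, hJ,
      genFun_listPairs_image_mul hc0, MvPowerSeries.expand, MvPowerSeries.substAlgHom_apply]

end Final
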